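/- **Order $q$ convergence of moments.** Let $|\cdot|$ be a norm on $\mathbb R^N$, let $\nu_1,\dots,\nu_M\in\mathbb Z^N$ and let $a_1,\dots,a_M:\mathbb Z^N\to[0,\infty)$. Let $X$ be the non-explosive càdlàg Markov process on $\mathbb Z^N$ that in state $x$ jumps by $\nu_j$ with intensity $a_j(x)$ (the waiting time is exponential with rate $a_0(x)=\sum_j a_j(x)$, and the next jump is $\nu_j$ with probability $a_j(x)/a_0(x)$), and let $P(\tau,x,x')=\mathrm{Prob}\{X(t+\tau)=x'\mid X(t)=x\}$. Let $\phi$ be a tau leap method: for all $\tau\ge 0$ and $x\in\mathbb Z^N$, $\phi(\tau,x,\cdot)$ is a probability mass function on $\mathbb Z^N$. For a mesh $\Pi=(t_0,\dots,t_n)$, $0=t_0<\dots<t_n=T$, with steps $\tau_j=t_j-t_{j-1}$ and $|\Pi|=\max_j\tau_j$, a tau leap solution $Y_\Pi$ is a process on $[0,T]$ that is constant on each $[t_{j-1},t_j)$ and satisfies $\mathrm{Prob}\{Y_\Pi(t_j)=x'\mid Y_\Pi(t_{j-1})=x\}=\phi(\tau_j,x,x')$. For $r\in\mathbb Z_+$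 and $g:\mathbb Z^N\to\mathbb R$ put $|g|_r=\sum_x\frac12(1+|x|^r)|g(x)|$, let $\mathcal M=\{g: |g|_r<\infty \text{ for all } r\}$, and let a matrix $\psi$ act by $(\psi g)(y)=\sum_x\psi(x,y)g(x)$. A superscript $(i)$ denotes the $i$-th derivative in $\tau\in[0,\infty)$. Let $q\in\mathbb Z_+$ and let $\lambda_r>0$, $\delta_r>0$ ($r\in\mathbb Z_+$) be constants. Assume: 1. there is $s^*\in\mathbb Z_+$ such that for every $j$ there is $\alpha>0$ with $|a_j(x)|\le\alpha(|x|^{s^*}+1)$ for all $x$; 2. $\sum_{x'}(1+|x'|^r)P(\tau,x,x')\le(1+|x|^r)e^{\lambda_r\tau}$ for all $r\in\mathbb Z_+$, $\tau>0$, $x$; 3. for all $x,x'$, $\phi(\cdot,x,x')$ is $q+1$ times continuously differentiable on $[0,\infty)$ and $\phi^{(i)}(0,x,x')=P^{(i)}(0,x,x')$ for $i=0,1,\dots,q$ (in particular $\phi(0)$ is the identity); 4. for each $r\in\mathbb Z_+$ there are $H_r>0$, $s_r\in\mathbb N$, $\gamma_r>0$ such that for all $\tau\in[0,\delta_r)$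 and all $x$ $$\sum_{x'}(1+|x'|^r)\,|\phi^{(q+1)}(\tau,x,x')|\le H_r(|x|^{s_r}+1)e^{\gamma_r\tau};\tag{a}$$ 5. $\sum_{x'}(1+|x'|^r)\phi(\tau,x,x')\le(1+|x|^r)e^{\lambda_r\tau}$ for all $r\in\mathbb Z_+$, $\tau\in[0,\delta_r)$, $x$. Let $r\in\mathbb Z_+$. Then $H_r>0$, $s_r\in\mathbb N$ and $\gamma_r>0$ can be chosen so that (a) holds for $\tau\in[0,\delta_r)$ and, in addition, $$\sum_{x'}(1+|x'|^r)\,|P^{(q+1)}(\tau,x,x')|\le H_r(|x|^{s_r}+1)e^{\gamma_r\tau}\qquad\text{for all }\tau>0 \text{ and all } x.\tag{b}$$ For any $H_r,s_r,\gamma_r$ such that (a) and (b) hold, there is $C_r>0$ with $$|(\phi(\tau)-P(\tau))g|_r\le C_r\,|g|_{s_r+r}\,\tau^{q+1}e^{\gamma_r\tau}\qquad\text{for all }\tau\in[0,\delta_r),\ g\in\mathcal M.\tag{c}$$ For any $C_r>0$ satisfying (c), put $\mu_r=\max\{\lambda_r,\lambda_{s_r+r},\gamma_r\}$. Then for every $T>0$,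 every mesh $\Pi$ on $[0,T]$ with $\tau=|\Pi|<\delta_r$, and every probability mass function $p_0\in\mathcal M$, if $X$ and $Y_\Pi$ both have initial distribution $p_0$, then the expectations below are finite and $$\big|E|Y_\Pi(T)|^r-E|X(T)|^r\big|\le 2C_r\,|p_0|_{s_r+r}\,T e^{\mu_rT}\tau^q= C_r\big(1+E|X(0)|^{s_r+r}\big)\,T e^{\mu_rT}\tau^q.$$ In particular, if $|X(0)|\ge1$ almost surely, then $$\big|E|Y_\Pi(T)|^r-E|X(T)|^r\big|\le 2C_r\,E\big(|X(0)|^{s_r+r}\big)\,T e^{\mu_rT}\tau^q .$$ So all moments of the tau leap approximation converge with order $q$. -/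

import Mathlib

open MeasureTheory ProbabilityTheory Set Filter Topology
open scoped NNReal ENNReal

noncomputable section

namespace TauLeap

/-- The state space `ℤ^N`. -/
abbrev State (N : ℕ) := Fin N → ℤ

/-- The value `|x|` of a norm on `ℝ^N` at a lattice point `x ∈ ℤ^N`. -/
def absv {N : ℕ} (nrm : Seminorm ℝ (Fin N → ℝ)) (x : State N) : ℝ :=
  nrm (fun i => (x i : ℝ))

/-! ### Chemical processes -/

/-- The rate `∑_{j : x + ν_j = y} a_j(x)` of jumping from `x` to `y ≠ x`. -/
def jumpRate {N M : ℕ} (ν : Fin M → State N) (a : Fin M → State N → ℝ) (x y : State N) : ℝ :=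
  ∑ j : Fin M, if x + ν j = y then a j x else 0

/-- The total rate of leaving `x`. It equals `a_0(x) = ∑_j a_j(x)` when all `ν_j` are nonzero
(a channel with `ν_j = 0` does not move the state). -/
def exitRate {N M : ℕ} (ν : Fin M → State N) (a : Fin M → State N → ℝ) (x : State N) : ℝ :=
  ∑ j : Fin M, if ν j = 0 then 0 else a j x

/-- The σ-algebra generated by the process up to time `s`. -/
@[reducible] def past {N : ℕ} {Ω : Type*} (X : ℝ≥0 → Ω → State N) (s : ℝ≥0) : MeasurableSpace Ω :=
  ⨆ u ∈ Iic s, MeasurableSpace.comap (X u) inferInstance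

/-- `X`, together with the laws `Pr x` (`x ∈ ℤ^N`) under which it starts at `x`, is the
non-explosive chemical process with stoichiometric vectors `ν_j` and propensities `a_j`:
a time-homogeneous Markov process with càdlàg paths for which, in state `x`, the waiting time for
the next jump is exponential with rate `a_0(x)` and, independently of it, the next jump leads
to `x + ν_j` with probability `a_j(x) / a_0(x)`.
As `ℤ^N` is discrete, càdlàg paths have only finitely many jumps in a bounded time interval. -/
structure IsChemicalProcess {N M : ℕ} (ν : Fin M → State N) (a : Fin M → State N → ℝ)
    {Ω : Type*} [MeasurableSpace Ω] (X : ℝ≥0 → Ω → State N) (Pr : State N → Measure Ω) : Prop where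
  nonneg : ∀ j x, 0 ≤ a j x
  prob : ∀ x, IsProbabilityMeasure (Pr x)
  measurable : ∀ t, Measurable (X t)
  start : ∀ x, ∀ᵐ ω ∂(Pr x), X 0 ω = x
  right_cont : ∀ ω t, ∀ᶠ u in 𝓝[>] t, X u ω = X t ω
  left_lim : ∀ ω t, 0 < t → ∃ y, ∀ᶠ u in 𝓝[<] t, X u ω = y
  markov : ∀ x s t y z A, MeasurableSet[past X s] A →
    Pr x (A ∩ {ω | X s ω = y} ∩ {ω | X (s + t) ω = z})
      = Pr x (A ∩ {ω | X s ω = y}) * Pr y {ω | X t ω = z}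
  waiting : ∀ x (t : ℝ≥0),
    Pr x {ω | ∀ u ≤ t, X u ω = x} = ENNReal.ofReal (Real.exp (-(exitRate ν a x * t)))
  jump : ∀ x y (t : ℝ≥0), y ≠ x →
    Pr x {ω | ∃ u ≤ t, (∀ v < u, X v ω = x) ∧ X u ω = y}
      = ENNReal.ofReal
          (jumpRate ν a x y / exitRate ν a x * (1 - Real.exp (-(exitRate ν a x * t))))

/-- The transition function `P(τ, x, x')` of the process, for `τ ≥ 0`. -/
def transition {N : ℕ} {Ω : Type*} [MeasurableSpace Ω] (X : ℝ≥0 → Ω → State N)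
    (Pr : State N → Measure Ω) (τ : ℝ) (x x' : State N) : ℝ :=
  (Pr x).real {ω | X τ.toNNReal ω = x'}

/-- The law of the process with initial distribution `p₀`. -/
def initLaw {N : ℕ} {Ω : Type*} [MeasurableSpace Ω] (Pr : State N → Measure Ω)
    (p₀ : State N → ℝ) : Measure Ω :=
  Measure.sum fun x => ENNReal.ofReal (p₀ x) • Pr x

/-! ### Moment variation -/

/-- `g` is a probability mass function on `ℤ^N`. -/
def IsProb {N : ℕ} (g : State N → ℝ) : Prop :=
  (∀ x, 0 ≤ g x) ∧ HasSum g 1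

/-- The `r`-th moment variation `|g|_r = ∑_x (1/2) (1 + |x|^r) |g(x)| ∈ [0, ∞]`. -/
def momVar {N : ℕ} (nrm : Seminorm ℝ (Fin N → ℝ)) (r : ℕ) (g : State N → ℝ) : ℝ≥0∞ :=
  ∑' x, ENNReal.ofReal (1 / 2 * (1 + absv nrm x ^ r) * |g x|)

/-- The space `𝓜` of functions all of whose moment variations are finite. -/
def MemM {N : ℕ} (nrm : Seminorm ℝ (Fin N → ℝ)) (g : State N → ℝ) : Prop :=
  ∀ r, momVar nrm r g < ∞

/-- The action `(ψ g)(y) = ∑_x ψ(x, y) g(x)` of an infinite matrix. -/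
def matApply {N : ℕ} (ψ : State N → State N → ℝ) (g : State N → ℝ) (y : State N) : ℝ :=
  ∑' x, ψ x y * g x

/-! ### Tau leap methods -/

/-- A tau leap method assigns to each step `τ ≥ 0` and state `x` a probability mass function
`φ(τ, x, ·)`. -/
def IsTauLeapMethod {N : ℕ} (φ : ℝ → State N → State N → ℝ) : Prop :=
  ∀ τ, 0 ≤ τ → ∀ x, IsProb (φ τ x)

/-- A mesh `0 = t_0 < t_1 < ⋯ < t_n = T`. -/
structure Mesh (T : ℝ≥0) where
  n : ℕ
  t : Fin (n + 1) → ℝ≥0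
  strictMono : StrictMono t
  first : t 0 = 0
  last : t (Fin.last n) = T

/-- The step size `t_{j+1} - t_j`. -/
def Mesh.step {T : ℝ≥0} (π : Mesh T) (j : Fin π.n) : ℝ :=
  (π.t j.succ : ℝ) - (π.t j.castSucc : ℝ)

/-- The maximum step size `|π|`. -/
def Mesh.size {T : ℝ≥0} (π : Mesh T) : ℝ :=
  ⨆ j, π.step j

/-- `Y` is a tau leap solution on the mesh `π` with initial distribution `p₀`. -/
structure IsTauLeapSolution {N : ℕ} (φ : ℝ → State N → State N → ℝ) {T : ℝ≥0} (π : Mesh T)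
    (p₀ : State N → ℝ) {Ω : Type*} [MeasurableSpace Ω] (μ : Measure Ω)
    (Y : ℝ≥0 → Ω → State N) : Prop where
  measurable : ∀ t ≤ T, Measurable (Y t)
  init : ∀ x, μ.real {ω | Y 0 ω = x} = p₀ x
  const : ∀ (j : Fin π.n) t, π.t j.castSucc ≤ t → t < π.t j.succ →
    ∀ ω, Y t ω = Y (π.t j.castSucc) ω
  trans : ∀ (j : Fin π.n) x x', μ {ω | Y (π.t j.castSucc) ω = x} ≠ 0 →
    (μ[|{ω | Y (π.t j.castSucc) ω = x}]).real {ω | Y (π.t j.succ) ω = x'} = φ (π.step j) x x'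

/-! ### Assumptions -/

/-- Polynomial growth of the propensities. -/
def PolyGrowth {N M : ℕ} (nrm : Seminorm ℝ (Fin N → ℝ)) (a : Fin M → State N → ℝ) : Prop :=
  ∃ s : ℕ, ∀ j, ∃ α > 0, ∀ x, |a j x| ≤ α * (absv nrm x ^ s + 1)

/-- The moment bound `∑_{x'} (1 + |x'|^r) ψ(τ, x, x') ≤ (1 + |x|^r) e^{lam τ}` for a step `τ`. -/
def MomGrowth {N : ℕ} (nrm : Seminorm ℝ (Fin N → ℝ)) (ψ : ℝ → State N → State N → ℝ)
    (r : ℕ) (lam : ℝ) (τ : ℝ) : Prop :=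
  ∀ x, ∑' x', ENNReal.ofReal ((1 + absv nrm x' ^ r) * ψ τ x x')
    ≤ ENNReal.ofReal ((1 + absv nrm x ^ r) * Real.exp (lam * τ))

/-- The `k`-th time derivative on `[0, ∞)` of a matrix-valued function of time. -/
def timeDeriv {N : ℕ} (k : ℕ) (ψ : ℝ → State N → State N → ℝ) (τ : ℝ) (x x' : State N) : ℝ :=
  iteratedDerivWithin k (fun u => ψ u x x') (Ici 0) τ

/-- Pointwise consistency of order `q`: `φ(·, x, x')` is `C^{q+1}` on `[0, ∞)`, and its time
derivatives at `0` of the orders `0, …, q` agree with those of `P`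
(order `0` says that `φ(0)` is the identity matrix). -/
def PointwiseConsistent {N : ℕ} (q : ℕ) (φ P : ℝ → State N → State N → ℝ) : Prop :=
  ∀ x x', ContDiffOn ℝ ((q + 1 : ℕ) : WithTop ℕ∞) (fun τ => φ τ x x') (Ici 0) ∧
    ∀ i ≤ q, timeDeriv i φ 0 x x' = timeDeriv i P 0 x x'

/-- The bound `∑_{x'} (1 + |x'|^r) |ψ^{(k)}(τ, x, x')| ≤ H (|x|^s + 1) e^{γ τ}` for a step `τ`. -/
def DerivBound {N : ℕ} (nrm : Seminorm ℝ (Fin N → ℝ)) (k : ℕ) (ψ : ℝ → State N → State N → ℝ)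
    (r : ℕ) (H : ℝ) (s : ℕ) (γ : ℝ) (τ : ℝ) : Prop :=
  ∀ x, ∑' x', ENNReal.ofReal ((1 + absv nrm x' ^ r) * |timeDeriv k ψ τ x x'|)
    ≤ ENNReal.ofReal (H * (absv nrm x ^ s + 1) * Real.exp (γ * τ))

/-- The local error bound
`|(φ(τ) - P(τ)) g|_r ≤ C |g|_{s+r} τ^{q+1} e^{γ τ}` for all `τ ∈ [0, δ)` and `g ∈ 𝓜`. -/
def LocalErrorBound {N : ℕ} (nrm : Seminorm ℝ (Fin N → ℝ)) (q : ℕ)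
    (φ P : ℝ → State N → State N → ℝ) (r s : ℕ) (γ δ C : ℝ) : Prop :=
  ∀ τ, 0 ≤ τ → τ < δ → ∀ g, MemM nrm g →
    momVar nrm r (matApply (fun x x' => φ τ x x' - P τ x x') g)
      ≤ ENNReal.ofReal C * momVar nrm (s + r) g
          * ENNReal.ofReal (τ ^ (q + 1) * Real.exp (γ * τ))

end TauLeap

end

namespace TauLeap

/-! ### Lower bounds for staying put and for a single jump. -/

section

/-! The global estimate is the classical "stability plus consistency" argument, run in the weighted
ℓ¹ norms `momVar`. With p_Y and p_X the two laws at a mesh point, one step of length τ gives φ(τ)p_Y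
− P(τ)p_X = φ(τ)(p_Y − p_X) + (φ(τ) − P(τ))p_X. The moment bound for φ lets the first term grow by
at most e^{λ_r τ}. The second is a local error at the exact law, of size τ^{q+1}, whose moments of
order s + r have grown by at most e^{λ_{s+r} t}. Summing along the mesh (`momVar_law_sub_le`) yields
a factor T e^{μT}|Π|^q, and moments are linear functionals bounded by twice the moment variation.

The local error comes from Taylor's principle: φ − P and its time derivatives up to order q vanish
at 0, and its derivative of order q + 1 is controlled in weighted ℓ¹ by (a) and (b). Each descent by
one order of derivative gains a factor τ (`tsum_abs_le_of_deriv`, `tsum_localError_le`).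

For (b), the backward equation shows that the k-th time derivative of P is L^k P, with L the
generator acting on the initial state. L is a finite sum with polynomially growing coefficients, so
each application raises the degree in |x| and keeps the exponential rate (`exists_derivBound`).

The backward equation has to be extracted from the laws of the waiting time and of the first jump.
Staying put, or jumping once and then staying, gives lower bounds for P(h, x, z). They sum to 1 +
o(h) over z, so conservation of mass turns them into matching upper bounds, and no estimate for two
or more jumps is needed. A squeeze gives the right derivative, and its continuity gives the full
one. -/

theorem tsum_measure_inter_fiber {N : ℕ} {Ω : Type*} [MeasurableSpace Ω] (μ : Measure Ω)
    {Z : Ω → State N} (hZ : Measurable Z) {B : Set Ω} (hB : MeasurableSet B) :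
    ∑' y, μ ({ω | Z ω = y} ∩ B) = μ B := by
  have hm : ∀ y, MeasurableSet {ω | Z ω = y} := fun y => hZ (measurableSet_singleton y)
  rw [← measure_iUnion]
  · congr 1
    ext ω
    simp
  · intro y z hyz
    refine Set.disjoint_left.2 ?_
    rintro ω ⟨h1, -⟩ ⟨h2, -⟩
    exact hyz (h1.symm.trans h2)
  · exact fun y => (hm y).inter hB

variable {N M : ℕ} {ν : Fin M → State N} {a : Fin M → State N → ℝ}
  {Ω : Type*} [MeasurableSpace Ω] {X : ℝ≥0 → Ω → State N} {Pr : State N → Measure Ω}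

namespace IsChemicalProcess

theorem measurableSet_fiber (hX : IsChemicalProcess ν a X Pr) (t : ℝ≥0) (y : State N) :
    MeasurableSet {ω | X t ω = y} :=
  hX.measurable t (measurableSet_singleton y)

theorem exitRate_nonneg (hX : IsChemicalProcess ν a X Pr) (x : State N) : 0 ≤ exitRate ν a x :=
  Finset.sum_nonneg fun j _ => by split_ifs <;> simp [hX.nonneg]

/-- The Chapman–Kolmogorov equation. -/
theorem chapmanKolmogorov (hX : IsChemicalProcess ν a X Pr) (x z : State N) (s t : ℝ≥0) :
    Pr x {ω | X (s + t) ω = z} = ∑' y, Pr x {ω | X s ω = y} * Pr y {ω | X t ω = z} := by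
  rw [← tsum_measure_inter_fiber (Pr x) (hX.measurable s) (hX.measurableSet_fiber (s + t) z)]
  refine tsum_congr fun y => ?_
  have := hX.markov x s t y z univ MeasurableSet.univ
  simpa using this

theorem exp_le_stay (hX : IsChemicalProcess ν a X Pr) (x : State N) (t : ℝ≥0) :
    ENNReal.ofReal (Real.exp (-(exitRate ν a x * t))) ≤ Pr x {ω | X t ω = x} := by
  rw [← hX.waiting x t]
  exact measure_mono fun ω hω => hω t le_rfl

/-- The process observed at the times `i h / (n + 1)` goes directly from `x` to `y` at
time `k h / (n + 1)`. -/
def gridJump (X : ℝ≥0 → Ω → State N) (x y : State N) (h : ℝ≥0) (n k : ℕ) : Set Ω :=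
  {ω | ∀ i < k, X (i * h / (n + 1)) ω = x} ∩ {ω | X (k * h / (n + 1)) ω = y}

theorem measurableSet_gridJump (hX : IsChemicalProcess ν a X Pr) (x y : State N) (h : ℝ≥0)
    (n k : ℕ) : MeasurableSet (gridJump X x y h n k) := by
  refine MeasurableSet.inter ?_ (hX.measurableSet_fiber _ _)
  simp only [ofPred_forall]
  exact MeasurableSet.iInter fun i => MeasurableSet.iInter fun _ => hX.measurableSet_fiber _ _

theorem disjoint_gridJump {N : ℕ} {Ω : Type*} {X : ℝ≥0 → Ω → State N} {x y : State N} (hxy : y ≠ x) (h : ℝ≥0) (n : ℕ) :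
    Pairwise (Function.onFun Disjoint (gridJump X x y h n)) := by
  have key : ∀ k l, k < l → Disjoint (gridJump X x y h n k) (gridJump X x y h n l) := by
    intro k l hkl
    refine Set.disjoint_left.2 ?_
    rintro ω ⟨-, h1⟩ ⟨h2, -⟩
    exact hxy (Eq.trans (Eq.symm h1) (h2 k hkl))
  intro k l hkl
  rcases lt_or_gt_of_ne hkl with h1 | h1
  · exact key k l h1
  · exact (key l k h1).symm

/-- This stands in for the strong Markov property at the jump time: on a grid the first visit to `y`
occurs at one of finitely many deterministic times, where the ordinary Markov property applies.
Staying at `y` for the remaining time, at most `h`, costs no more than the exponential factor. -/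
theorem measure_gridJump_le (hX : IsChemicalProcess ν a X Pr) {x y : State N} (hxy : y ≠ x)
    (h : ℝ≥0) (n : ℕ) :
    Pr x (⋃ k ∈ Finset.range (n + 2), gridJump X x y h n k)
        * ENNReal.ofReal (Real.exp (-(exitRate ν a y * h))) ≤ Pr x {ω | X h ω = y} := by
  have hd := disjoint_gridJump (X := X) hxy h n
  rw [measure_biUnion_finset (fun k _ l _ hkl => hd hkl)
    (fun k _ => hX.measurableSet_gridJump x y h n k), Finset.sum_mul]
  calc _ ≤ ∑ k ∈ Finset.range (n + 2), Pr x (gridJump X x y h n k ∩ {ω | X h ω = y}) := by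
        refine Finset.sum_le_sum fun k hk => ?_
        have hk' : k ≤ n + 1 := by have := Finset.mem_range.1 hk; omega
        have hle : k * h / (n + 1) ≤ h := by
          rw [div_le_iff₀ (by positivity), mul_comm h]
          gcongr
          exact_mod_cast hk'
        have hA : MeasurableSet[past X (k * h / (n + 1))]
            {ω | ∀ i < k, X (i * h / (n + 1)) ω = x} := by
          simp only [ofPred_forall]
          refine MeasurableSet.iInter fun i => MeasurableSet.iInter fun hi => ?_
          have hle' : MeasurableSpace.comap (X (i * h / (n + 1))) inferInstance
              ≤ past X (k * h / (n + 1)) := by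
            refine le_iSup₂_of_le (i * h / (n + 1)) ?_ le_rfl
            simp only [mem_Iic]
            gcongr
          exact hle' _ ⟨{x}, measurableSet_singleton x, rfl⟩
        have hm := hX.markov x (k * h / (n + 1)) (h - k * h / (n + 1)) y y _ hA
        rw [add_tsub_cancel_of_le hle] at hm
        rw [gridJump, hm]
        gcongr
        refine le_trans ?_ (hX.exp_le_stay y _)
        have := hX.exitRate_nonneg y
        gcongr
        exact tsub_le_self
    _ = Pr x (⋃ k ∈ Finset.range (n + 2), (gridJump X x y h n k ∩ {ω | X h ω = y})) := by
        rw [measure_biUnion_finset]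
        · exact fun k _ l _ hkl => (hd hkl).mono inter_subset_left inter_subset_left
        · exact fun k _ => (hX.measurableSet_gridJump x y h n k).inter
            (hX.measurableSet_fiber _ _)
    _ ≤ _ := measure_mono (iUnion₂_subset fun k _ => inter_subset_right)

/-- By right continuity the path stays at `y` on some `[u, c)`. Once the grid spacing is below `c -
u`, the first grid point at or after `u` falls in this interval, and all earlier grid points see
`x`. -/
theorem eventually_mem_gridJump (hX : IsChemicalProcess ν a X Pr) {x y : State N} {h : ℝ≥0}
    {ω : Ω} (hω : ∃ u ≤ h, (∀ v < u, X v ω = x) ∧ X u ω = y) :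
    ∀ᶠ n : ℕ in atTop, ω ∈ ⋃ k ∈ Finset.range (n + 2), gridJump X x y h n k := by
  obtain ⟨u, huh, hux, huy⟩ := hω
  rcases eq_or_ne h 0 with rfl | hh
  · refine Eventually.of_forall fun n => ?_
    have hu : u = 0 := le_antisymm huh zero_le
    subst hu
    refine mem_iUnion₂.2 ⟨0, by simp, ?_⟩
    simp [gridJump, huy]
  have hh' : 0 < h := pos_iff_ne_zero.2 hh
  obtain ⟨c, hc, hcy⟩ : ∃ c > u, ∀ v, u ≤ v → v < c → X v ω = y := by
    have := hX.right_cont ω u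
    rw [huy] at this
    obtain ⟨c, hc, hcs⟩ := (mem_nhdsGT_iff_exists_Ioo_subset' (show u < u + 1 by simp)).1 this
    refine ⟨c, hc, fun v hv hvc => ?_⟩
    rcases hv.eq_or_lt with rfl | hv
    · exact huy
    · exact hcs ⟨hv, hvc⟩
  have hlim : Tendsto (fun n : ℕ => (h : ℝ) / ((n : ℝ) + 1)) atTop (𝓝 0) :=
    ((tendsto_const_div_atTop_nhds_zero_nat (h : ℝ)).comp (tendsto_add_atTop_nat 1)).congr
      fun n => by simp
  have hcu : (0 : ℝ) < c - u := sub_pos.2 (by exact_mod_cast hc)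
  filter_upwards [hlim.eventually (gt_mem_nhds hcu)] with n hn
  have hn0 : (0 : ℝ≥0) < n + 1 := by positivity
  set k := ⌈u * (n + 1) / h⌉₊ with hk
  have hk1 : u ≤ k * h / (n + 1) := by
    rw [le_div_iff₀ hn0, ← div_le_iff₀ hh']
    exact Nat.le_ceil _
  refine mem_iUnion₂.2 ⟨k, ?_, ?_, ?_⟩
  · rw [Finset.mem_range, Nat.lt_succ_iff, hk, Nat.ceil_le, div_le_iff₀ hh', mul_comm]
    push_cast
    gcongr
  · intro i hi
    refine hux _ ?_
    rw [div_lt_iff₀ hn0, ← lt_div_iff₀ hh']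
    exact Nat.lt_ceil.1 hi
  · refine hcy _ hk1 ?_
    have h1 : (k : ℝ≥0) < u * (n + 1) / h + 1 := Nat.ceil_lt_add_one zero_le
    have h2 : (k * h : ℝ≥0) < u * (n + 1) + h := by
      calc (k * h : ℝ≥0) < (u * (n + 1) / h + 1) * h := by gcongr
        _ = _ := by rw [add_mul, div_mul_cancel₀ _ hh, one_mul]
    rw [div_lt_iff₀ hn0]
    have h3 : (h : ℝ) < (c - u) * (n + 1) := (div_lt_iff₀ (by positivity)).1 hn
    have h4 : (u * (n + 1) + h : ℝ≥0) < c * (n + 1) := by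
      rw [← NNReal.coe_lt_coe]
      push_cast
      linarith
    exact h2.trans h4

theorem firstJump_le (hX : IsChemicalProcess ν a X Pr) {x y : State N} (hxy : y ≠ x) (h : ℝ≥0) :
    ENNReal.ofReal (jumpRate ν a x y / exitRate ν a x * (1 - Real.exp (-(exitRate ν a x * h)))
      * Real.exp (-(exitRate ν a y * h))) ≤ Pr x {ω | X h ω = y} := by
  set c := ENNReal.ofReal (Real.exp (-(exitRate ν a y * h))) with hc
  have hc0 : c ≠ 0 := by simp [hc, Real.exp_pos]
  have hct : c ≠ ∞ := ENNReal.ofReal_ne_top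
  rw [ENNReal.ofReal_mul' (Real.exp_pos _).le, ← hX.jump x y h hxy, ← hc,
    ← ENNReal.le_div_iff_mul_le (Or.inl hc0) (Or.inl hct)]
  set G : ℕ → Set Ω := fun n => ⋃ k ∈ Finset.range (n + 2), gridJump X x y h n k
  have hG : ∀ n, Pr x (G n) ≤ Pr x {ω | X h ω = y} / c := fun n => by
    rw [ENNReal.le_div_iff_mul_le (Or.inl hc0) (Or.inl hct)]
    exact hX.measure_gridJump_le hxy h n
  have hsub : {ω | ∃ u ≤ h, (∀ v < u, X v ω = x) ∧ X u ω = y} ⊆ ⋃ m, ⋂ n ≥ m, G n := by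
    intro ω hω
    obtain ⟨m, hm⟩ := eventually_atTop.1 (hX.eventually_mem_gridJump hω)
    exact mem_iUnion.2 ⟨m, mem_iInter₂.2 hm⟩
  refine (measure_mono hsub).trans ?_
  -- The tails of the liminf increase, so continuity from below applies and each tail is bounded by
  -- a single `G m`.
  have hmono : Monotone fun m => ⋂ n ≥ m, G n := fun m m' hmm =>
    biInter_mono (fun n hn => le_trans hmm hn) fun _ _ => Subset.rfl
  rw [hmono.measure_iUnion]
  exact iSup_le fun m => (measure_mono (iInter₂_subset m le_rfl)).trans (hG m)

end IsChemicalProcess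

end

/-! ### The Kolmogorov backward equation and smoothness in time. -/

section

/-- The generator `(L f)(x) = ∑_j a_j(x) (f(x + ν_j) - f(x))`. -/
def gen {N M : ℕ} (ν : Fin M → State N) (a : Fin M → State N → ℝ) (f : State N → ℝ)
    (x : State N) : ℝ :=
  ∑ j, a j x * (f (x + ν j) - f x)

theorem hasDerivWithinAt_of_squeeze {f lo hi : ℝ → ℝ} {c t : ℝ}
    (hlo : HasDerivWithinAt lo c (Ioi t) t) (hhi : HasDerivWithinAt hi c (Ioi t) t)
    (h1 : ∀ u, t ≤ u → lo u ≤ f u) (h2 : ∀ u, t ≤ u → f u ≤ hi u) (h3 : lo t = hi t) :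
    HasDerivWithinAt f c (Ioi t) t := by
  have hft : f t = lo t := le_antisymm (h3 ▸ h2 t le_rfl) (h1 t le_rfl)
  rw [hasDerivWithinAt_iff_tendsto_slope' (by simp)] at hlo hhi ⊢
  refine tendsto_of_tendsto_of_tendsto_of_le_of_le' hlo hhi ?_ ?_
  all_goals
    filter_upwards [self_mem_nhdsWithin] with u hu
    have hu' : 0 < u - t := sub_pos.2 hu
    rw [slope_def_field, slope_def_field]
    gcongr ?_ / _
  · linarith [h1 u (le_of_lt hu)]
  · linarith [h2 u (le_of_lt hu)]

theorem hasSum_of_tsum_ofReal {ι : Type*} {f : ι → ℝ} {c : ℝ} (hf : ∀ i, 0 ≤ f i) (hc : 0 ≤ c)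
    (h : ∑' i, ENNReal.ofReal (f i) = ENNReal.ofReal c) : HasSum f c := by
  have h2 := (ENNReal.summable (f := fun i => ENNReal.ofReal (f i))).hasSum
  rw [h] at h2
  lift f to ι → ℝ≥0 using hf
  lift c to ℝ≥0 using hc
  simp only [ENNReal.ofReal_coe_nnreal] at h2
  exact NNReal.hasSum_coe.2 (ENNReal.hasSum_coe.1 h2)

/-- Channels are regrouped by target, since several may share one. Those with `ν j = 0` lead to the
erased point `x` and contribute nothing to the generator either. -/
theorem sum_jumpRate_mul {N M : ℕ} (ν : Fin M → State N) (a : Fin M → State N → ℝ)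
    (f : State N → ℝ) (x : State N) :
    ∑ z ∈ (Finset.univ.image fun j => x + ν j).erase x, jumpRate ν a x z * f z
      = gen ν a f x + exitRate ν a x * f x := by
  simp only [jumpRate, gen, exitRate, Finset.sum_mul]
  rw [Finset.sum_comm, ← Finset.sum_add_distrib]
  refine Finset.sum_congr rfl fun j _ => ?_
  by_cases hj : ν j = 0
  · rw [Finset.sum_eq_zero]
    · simp [hj]
    · intro z hz
      have := Finset.ne_of_mem_erase hz
      rw [hj, add_zero, if_neg this.symm, zero_mul]
  · rw [Finset.sum_eq_single (x + ν j)]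
    · simp [hj]
      ring
    · intro z _ hz
      rw [if_neg hz.symm, zero_mul]
    · intro hz
      simp [hj] at hz

variable {N M : ℕ} {ν : Fin M → State N} {a : Fin M → State N → ℝ}
  {Ω : Type*} [MeasurableSpace Ω] {X : ℝ≥0 → Ω → State N} {Pr : State N → Measure Ω}

theorem transition_nonneg (t : ℝ) (x y : State N) : 0 ≤ transition X Pr t x y :=
  measureReal_nonneg

namespace IsChemicalProcess

theorem ofReal_transition (hX : IsChemicalProcess ν a X Pr) (t : ℝ) (x y : State N) :
    ENNReal.ofReal (transition X Pr t x y) = Pr x {ω | X t.toNNReal ω = y} := by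
  have := hX.prob x
  exact ofReal_measureReal

theorem isProb_transition (hX : IsChemicalProcess ν a X Pr) (t : ℝ) (x : State N) :
    IsProb (transition X Pr t x) := by
  refine ⟨fun y => transition_nonneg t x y, ?_⟩
  have := hX.prob x
  have h1 : ∑' y, ENNReal.ofReal (transition X Pr t x y) = 1 := by
    simp only [hX.ofReal_transition]
    have := tsum_measure_inter_fiber (Pr x) (hX.measurable t.toNNReal) MeasurableSet.univ
    simpa using this
  exact hasSum_of_tsum_ofReal (fun y => transition_nonneg t x y) zero_le_one
    (h1.trans ENNReal.ofReal_one.symm)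

theorem transition_le_one (hX : IsChemicalProcess ν a X Pr) (t : ℝ) (x y : State N) :
    transition X Pr t x y ≤ 1 := by
  have := hX.prob x
  exact measureReal_le_one

theorem transition_zero (hX : IsChemicalProcess ν a X Pr) (x y : State N) :
    transition X Pr 0 x y = if x = y then 1 else 0 := by
  have := hX.prob x
  have h1 : {ω | X 0 ω = y} =ᵐ[Pr x] {_ω | x = y} :=
    (hX.start x).mono fun ω hω => congrArg (· = y) hω
  rw [transition, Real.toNNReal_zero, measureReal_congr h1]
  split_ifs with h
  · subst h
    simp
  · simp [h]

theorem hasSum_transition_mul (hX : IsChemicalProcess ν a X Pr) {s t : ℝ} (hs : 0 ≤ s)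
    (ht : 0 ≤ t) (x y : State N) :
    HasSum (fun z => transition X Pr s x z * transition X Pr t z y)
      (transition X Pr (s + t) x y) := by
  have h1 := hX.chapmanKolmogorov x y s.toNNReal t.toNNReal
  rw [← Real.toNNReal_add hs ht, ← hX.ofReal_transition] at h1
  simp only [← hX.ofReal_transition] at h1
  simp only [← ENNReal.ofReal_mul (transition_nonneg (X := X) (Pr := Pr) s x _)] at h1
  exact hasSum_of_tsum_ofReal (fun z => mul_nonneg (transition_nonneg _ _ _)
    (transition_nonneg _ _ _)) (transition_nonneg _ _ _) h1.symm

theorem sum_mul_le_transition (hX : IsChemicalProcess ν a X Pr) {s t : ℝ} (hs : 0 ≤ s)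
    (ht : 0 ≤ t) (x y : State N) (S : Finset (State N)) (l : State N → ℝ)
    (hl : ∀ z ∈ S, l z ≤ transition X Pr s x z) :
    ∑ z ∈ S, l z * transition X Pr t z y ≤ transition X Pr (s + t) x y :=
  (Finset.sum_le_sum fun z hz =>
    mul_le_mul_of_nonneg_right (hl z hz) (transition_nonneg _ _ _)).trans
    (sum_le_hasSum S (fun _ _ => mul_nonneg (transition_nonneg _ _ _) (transition_nonneg _ _ _))
      (hX.hasSum_transition_mul hs ht x y))

/-- Conservation of mass: `1 - P(s + t, x, y)` is the sum of the nonnegative terms `P(s, x, z) * (1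
- P(t, z, y))`, so lower bounds for the first step also bound the transition function from above. -/
theorem transition_le_sum_mul (hX : IsChemicalProcess ν a X Pr) {s t : ℝ} (hs : 0 ≤ s)
    (ht : 0 ≤ t) (x y : State N) (S : Finset (State N)) (l : State N → ℝ)
    (hl : ∀ z ∈ S, l z ≤ transition X Pr s x z) :
    transition X Pr (s + t) x y
      ≤ ∑ z ∈ S, l z * transition X Pr t z y + (1 - ∑ z ∈ S, l z) := by
  have h1 := (hX.isProb_transition s x).2.sub (hX.hasSum_transition_mul hs ht x y)
  have h2 : ∑ z ∈ S, (l z - l z * transition X Pr t z y) ≤ 1 - transition X Pr (s + t) x y := by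
    refine (Finset.sum_le_sum fun z hz => ?_).trans (sum_le_hasSum S (fun z _ => ?_) h1)
    · have := mul_le_mul_of_nonneg_right (hl z hz) (sub_nonneg.2 (hX.transition_le_one t z y))
      linarith
    · have := mul_nonneg (transition_nonneg (X := X) (Pr := Pr) s x z)
        (sub_nonneg.2 (hX.transition_le_one t z y))
      linarith
  rw [Finset.sum_sub_distrib] at h2
  linarith

theorem exp_le_transition (hX : IsChemicalProcess ν a X Pr) {t : ℝ} (ht : 0 ≤ t) (x : State N) :
    Real.exp (-(exitRate ν a x * t)) ≤ transition X Pr t x x := by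
  rw [← ENNReal.ofReal_le_ofReal_iff (transition_nonneg _ _ _), hX.ofReal_transition]
  have := hX.exp_le_stay x t.toNNReal
  rwa [Real.coe_toNNReal t ht] at this

theorem firstJump_le_transition (hX : IsChemicalProcess ν a X Pr) {t : ℝ} (ht : 0 ≤ t)
    {x y : State N} (hxy : y ≠ x) :
    jumpRate ν a x y / exitRate ν a x * (1 - Real.exp (-(exitRate ν a x * t)))
      * Real.exp (-(exitRate ν a y * t)) ≤ transition X Pr t x y := by
  rw [← ENNReal.ofReal_le_ofReal_iff (transition_nonneg _ _ _), hX.ofReal_transition]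
  have := hX.firstJump_le hxy t.toNNReal
  rwa [Real.coe_toNNReal t ht] at this

theorem lipschitz_transition (hX : IsChemicalProcess ν a X Pr) (x y : State N) {t h : ℝ}
    (ht : 0 ≤ t) (hh : 0 ≤ h) :
    |transition X Pr (t + h) x y - transition X Pr t x y| ≤ exitRate ν a x * h := by
  have h0 := Real.add_one_le_exp (-(exitRate ν a x * h))
  have h1 := hX.sum_mul_le_transition hh ht x y {x} (fun _ => Real.exp (-(exitRate ν a x * h)))
    (by simpa using hX.exp_le_transition hh x)
  have h2 := hX.transition_le_sum_mul hh ht x y {x} (fun _ => Real.exp (-(exitRate ν a x * h)))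
    (by simpa using hX.exp_le_transition hh x)
  rw [Finset.sum_singleton] at h1 h2
  rw [Finset.sum_singleton] at h2
  rw [add_comm h t] at h1 h2
  have h3 : Real.exp (-(exitRate ν a x * h)) ≤ 1 := by
    rw [Real.exp_le_one_iff]
    have := mul_nonneg (hX.exitRate_nonneg x) hh
    linarith
  have h4 := transition_nonneg (X := X) (Pr := Pr) t x y
  have h5 := hX.transition_le_one t x y
  rw [abs_le]
  constructor <;> nlinarith

theorem continuous_transition (hX : IsChemicalProcess ν a X Pr) (x y : State N) :
    Continuous fun t => transition X Pr t x y := by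
  have hL : LipschitzWith ⟨exitRate ν a x, hX.exitRate_nonneg x⟩
      (fun t : ℝ≥0 => transition X Pr t x y) := by
    refine LipschitzWith.of_dist_le_mul fun s t => ?_
    wlog hst : s ≤ t generalizing s t
    · rw [dist_comm, dist_comm s]
      exact this t s (le_of_not_ge hst)
    have := hX.lipschitz_transition x y (t := s) (h := t - s) s.2 (sub_nonneg.2 hst)
    rw [add_sub_cancel] at this
    rw [dist_comm, dist_comm s, Real.dist_eq, NNReal.dist_eq,
      abs_of_nonneg (a := (t : ℝ) - s) (sub_nonneg.2 hst)]
    exact this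
  have := hL.continuous.comp continuous_real_toNNReal
  refine this.congr fun t => ?_
  simp [transition]

theorem hasDerivWithinAt_Ioi_transition (hX : IsChemicalProcess ν a X Pr) (x y : State N) {t : ℝ}
    (ht : 0 ≤ t) :
    HasDerivWithinAt (fun u => transition X Pr u x y)
      (gen ν a (fun z => transition X Pr t z y) x) (Ioi t) t := by
  classical
  set T := (Finset.univ.image fun j => x + ν j).erase x with hT
  have hxT : x ∉ T := Finset.notMem_erase _ _
  set l : State N → ℝ → ℝ := fun z h => if z = x then Real.exp (-(exitRate ν a x * h)) else
    jumpRate ν a x z / exitRate ν a x * (1 - Real.exp (-(exitRate ν a x * h)))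
      * Real.exp (-(exitRate ν a z * h)) with hl
  have hle : ∀ h, 0 ≤ h → ∀ z ∈ insert x T, l z h ≤ transition X Pr h x z := by
    intro h hh z _
    by_cases hz : z = x
    · simpa [hl, hz] using hX.exp_le_transition hh x
    · simpa [hl, hz] using hX.firstJump_le_transition hh hz
  have hexp : ∀ c : ℝ, HasDerivAt (fun u => Real.exp (-(c * (u - t)))) (-c) t := by
    intro c
    have h1 : HasDerivAt (fun u => -(c * (u - t))) (-(c * 1)) t :=
      (((hasDerivAt_id t).sub_const t).const_mul c).neg
    simpa using h1.exp
  have hlx : HasDerivAt (fun u => l x (u - t)) (-exitRate ν a x) t := by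
    simpa [hl] using hexp (exitRate ν a x)
  have hlz : ∀ z ∈ T, HasDerivAt (fun u => l z (u - t)) (jumpRate ν a x z) t := by
    intro z hz
    have hzx : z ≠ x := fun h => hxT (h ▸ hz)
    have h1 := ((((hexp (exitRate ν a x)).const_sub 1).const_mul
      (jumpRate ν a x z / exitRate ν a x)).mul (hexp (exitRate ν a z)))
    -- When the exit rate is 0 the quotient is 0 by convention, which is harmless because all jump
    -- rates to `z ≠ x` then vanish too.
    have h2 : jumpRate ν a x z / exitRate ν a x * exitRate ν a x = jumpRate ν a x z := by
      refine div_mul_cancel_of_imp fun h0 => ?_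
      refine Finset.sum_eq_zero fun j _ => ?_
      split_ifs with hj
      · have h3 := (Finset.sum_eq_zero_iff_of_nonneg (fun j _ => by
          split_ifs <;> simp [hX.nonneg])).1 h0 j (Finset.mem_univ j)
        rw [if_neg] at h3
        · exact h3
        · rintro h4
          exact hzx (by simpa [h4] using hj.symm)
      · rfl
    simp only [hl, hzx, if_false]
    refine h1.congr_deriv ?_
    simp [h2]
  have hsum : ∀ f : State N → ℝ, HasDerivAt (fun u => ∑ z ∈ insert x T, l z (u - t) * f z)
      (gen ν a f x) t := by
    intro f
    have h1 : HasDerivAt (fun u => l x (u - t) * f x + ∑ z ∈ T, l z (u - t) * f z)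
        (-exitRate ν a x * f x + ∑ z ∈ T, jumpRate ν a x z * f z) t :=
      (hlx.mul_const _).add (HasDerivAt.fun_sum fun z hz => (hlz z hz).mul_const _)
    rw [sum_jumpRate_mul] at h1
    simp only [Finset.sum_insert hxT]
    convert h1 using 1
    ring
  have hval : ∀ f : State N → ℝ, ∑ z ∈ insert x T, l z (t - t) * f z = f x := by
    intro f
    rw [Finset.sum_insert hxT, Finset.sum_eq_zero]
    · simp [hl]
    · intro z hz
      have hzx : z ≠ x := fun h => hxT (h ▸ hz)
      simp [hl, hzx]
  set F : State N → ℝ := fun z => transition X Pr t z y with hF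
  refine hasDerivWithinAt_of_squeeze
    (lo := fun u => ∑ z ∈ insert x T, l z (u - t) * F z)
    (hi := fun u => ∑ z ∈ insert x T, l z (u - t) * F z
      + (1 - ∑ z ∈ insert x T, l z (u - t) * 1))
    (hsum F).hasDerivWithinAt ?_ ?_ ?_ ?_
  -- The two bounds differ by the missing mass, whose derivative is minus the generator applied to
  -- the constant 1, hence 0.
  · have h1 := (hsum F).add ((hsum fun _ => 1).const_sub 1)
    refine (h1.congr_deriv ?_).hasDerivWithinAt
    simp [gen]
  · intro u hu
    have := hX.sum_mul_le_transition (sub_nonneg.2 hu) ht x y _ _ (hle _ (sub_nonneg.2 hu))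
    rwa [sub_add_cancel] at this
  · intro u hu
    have := hX.transition_le_sum_mul (sub_nonneg.2 hu) ht x y _ _ (hle _ (sub_nonneg.2 hu))
    rw [sub_add_cancel] at this
    simpa only [mul_one] using this
  · have h1 := hval fun _ => 1
    simp only [h1, sub_self (1 : ℝ), add_zero]

/-- The Kolmogorov backward equation. -/
theorem hasDerivWithinAt_transition (hX : IsChemicalProcess ν a X Pr) (x y : State N) {t : ℝ}
    (ht : 0 ≤ t) :
    HasDerivWithinAt (fun u => transition X Pr u x y)
      (gen ν a (fun z => transition X Pr t z y) x) (Ici 0) t := by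
  set G : ℝ → ℝ := fun u => gen ν a (fun z => transition X Pr u z y) x
  have hG : Continuous G := continuous_finsetSum _ fun j _ =>
    continuous_const.mul ((hX.continuous_transition _ _).sub (hX.continuous_transition _ _))
  -- A continuous right derivative makes the function an integral, hence two-sidedly differentiable.
  -- `G` is continuous on the whole line since `transition` is frozen at time 0 for negative times.
  have hI : ∀ u, 0 ≤ u →
      transition X Pr u x y = (∫ s in (0 : ℝ)..u, G s) + transition X Pr 0 x y := by
    intro u hu
    rw [intervalIntegral.integral_eq_sub_of_hasDeriv_right_of_le hu
      (hX.continuous_transition x y).continuousOn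
      (fun s hs => hX.hasDerivWithinAt_Ioi_transition x y hs.1.le) (hG.intervalIntegrable _ _)]
    ring
  have h1 : HasDerivAt (fun u => (∫ s in (0 : ℝ)..u, G s) + transition X Pr 0 x y) (G t) t :=
    (hG.integral_hasStrictDerivAt 0 t).hasDerivAt.add_const _
  exact h1.hasDerivWithinAt.congr (fun u hu => hI u hu) (hI t ht)

/-- The generator involves only finitely many states at each point, so differentiation passes
through it term by term. -/
theorem hasDerivWithinAt_iterate_gen (hX : IsChemicalProcess ν a X Pr) (k : ℕ) (x y : State N)
    {t : ℝ} (ht : 0 ≤ t) :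
    HasDerivWithinAt (fun u => (gen ν a)^[k] (fun z => transition X Pr u z y) x)
      ((gen ν a)^[k + 1] (fun z => transition X Pr t z y) x) (Ici 0) t := by
  induction k generalizing x with
  | zero => exact hX.hasDerivWithinAt_transition x y ht
  | succ k ih =>
    rw [Function.iterate_succ_apply' _ (k + 1)]
    generalize (gen ν a)^[k + 1] (fun z => transition X Pr t z y) = D at ih ⊢
    simp only [Function.iterate_succ_apply' _ k]
    exact HasDerivWithinAt.fun_sum fun j _ => ((ih _).fun_sub (ih _)).const_mul _

theorem timeDeriv_transition (hX : IsChemicalProcess ν a X Pr) (k : ℕ) (x y : State N)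
    {t : ℝ} (ht : 0 ≤ t) :
    timeDeriv k (transition X Pr) t x y
      = (gen ν a)^[k] (fun z => transition X Pr t z y) x := by
  induction k generalizing t with
  | zero => simp [timeDeriv]
  | succ k ih =>
    rw [timeDeriv, iteratedDerivWithin_succ]
    refine (derivWithin_congr (fun u (hu : 0 ≤ u) => ih hu) (ih ht)).trans ?_
    exact (hX.hasDerivWithinAt_iterate_gen k x y ht).derivWithin
      (uniqueDiffOn_Ici 0 t ht)

theorem contDiffOn_transition (hX : IsChemicalProcess ν a X Pr) (x y : State N) (n : ℕ) :
    ContDiffOn ℝ (n : WithTop ℕ∞) (fun u => transition X Pr u x y) (Ici 0) := by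
  have h : ContDiffOn ℝ ((n : ℕ∞) : WithTop ℕ∞) (fun u => transition X Pr u x y) (Ici 0) := by
    refine contDiffOn_of_differentiableOn_deriv fun m _ => ?_
    intro t ht
    refine DifferentiableWithinAt.congr
      (hX.hasDerivWithinAt_iterate_gen m x y ht).differentiableWithinAt
      (fun u hu => hX.timeDeriv_transition m x y hu) (hX.timeDeriv_transition m x y ht)
  exact_mod_cast h

end IsChemicalProcess

end

/-! ### Elementary inequalities for powers of the norm. -/

theorem absv_nonneg {N : ℕ} (nrm : Seminorm ℝ (Fin N → ℝ)) (x : State N) : 0 ≤ absv nrm x :=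
  apply_nonneg nrm _

theorem absv_add_le {N : ℕ} (nrm : Seminorm ℝ (Fin N → ℝ)) (x y : State N) :
    absv nrm (x + y) ≤ absv nrm x + absv nrm y := by
  refine le_trans (le_of_eq ?_) (map_add_le_add nrm _ _)
  rw [absv]
  congr 1
  ext i
  simp

theorem pow_le_pow_add_one {u : ℝ} (hu : 0 ≤ u) {m n : ℕ} (hmn : m ≤ n) : u ^ m ≤ u ^ n + 1 := by
  rcases le_total u 1 with h | h
  · exact (pow_le_one₀ hu h).trans (le_add_of_nonneg_left (pow_nonneg hu n))
  · exact (pow_le_pow_right₀ h hmn).trans (le_add_of_nonneg_right zero_le_one)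

theorem pow_add_one_mul_le {u : ℝ} (hu : 0 ≤ u) (m n : ℕ) :
    (u ^ m + 1) * (u ^ n + 1) ≤ 3 * (u ^ (m + n) + 1) := by
  have h1 := pow_le_pow_add_one hu (Nat.le_add_right m n)
  have h2 := pow_le_pow_add_one hu (Nat.le_add_left n m)
  have h3 : (u ^ m + 1) * (u ^ n + 1) = u ^ (m + n) + u ^ m + u ^ n + 1 := by ring
  linarith [pow_nonneg hu (m + n)]

theorem absv_add_pow_le {N : ℕ} (nrm : Seminorm ℝ (Fin N → ℝ)) (x y : State N) (s : ℕ) :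
    absv nrm (x + y) ^ s + 1 ≤ (2 ^ s * (1 + absv nrm y ^ s) + 1) * (absv nrm x ^ s + 1) := by
  have hx := absv_nonneg nrm x
  have hy := absv_nonneg nrm y
  have h1 : absv nrm (x + y) ^ s ≤ 2 ^ (s - 1) * (absv nrm x ^ s + absv nrm y ^ s) :=
    (pow_le_pow_left₀ (absv_nonneg nrm _) (absv_add_le nrm x y) s).trans (add_pow_le hx hy s)
  have h2 : (2 : ℝ) ^ (s - 1) ≤ 2 ^ s := pow_le_pow_right₀ one_le_two (Nat.sub_le s 1)
  have h3 : (0 : ℝ) ≤ absv nrm x ^ s := pow_nonneg hx s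
  have h4 : (0 : ℝ) ≤ absv nrm y ^ s := pow_nonneg hy s
  have h5 := mul_le_mul_of_nonneg_right h2 (add_nonneg h3 h4)
  have h6 : (0 : ℝ) ≤ 2 ^ s := by positivity
  nlinarith [mul_nonneg h6 (mul_nonneg h3 h4)]

theorem pow_add_one_le_two_mul {u : ℝ} (hu : 0 ≤ u) (s r : ℕ) :
    u ^ s + 1 ≤ 2 * (1 + u ^ (s + r)) := by
  have := pow_le_pow_add_one hu (Nat.le_add_right s r)
  linarith [pow_nonneg hu (s + r)]

/-! ### Derivatives of the transition function -/

/-- The factor 2 pays for raising the exponent: `u ^ s + 1 ≤ 2 * (u ^ s' + 1)`. -/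
theorem DerivBound.mono {N : ℕ} {nrm : Seminorm ℝ (Fin N → ℝ)} {k : ℕ}
    {ψ : ℝ → State N → State N → ℝ} {r : ℕ} {H H' γ γ' τ : ℝ} {s s' : ℕ}
    (h : DerivBound nrm k ψ r H s γ τ) (hH : 0 ≤ H) (hs : s ≤ s') (hH' : 2 * H ≤ H')
    (hγ : γ ≤ γ') (hτ : 0 ≤ τ) : DerivBound nrm k ψ r H' s' γ' τ := by
  intro x
  refine (h x).trans (ENNReal.ofReal_le_ofReal ?_)
  have hx := absv_nonneg nrm x
  have h1 := pow_le_pow_add_one hx hs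
  have h2 := pow_nonneg hx s'
  have h3 : H * (absv nrm x ^ s + 1) ≤ H' * (absv nrm x ^ s' + 1) := by nlinarith
  have h4 : 0 ≤ H' * (absv nrm x ^ s' + 1) := by
    have : 0 ≤ H' := by linarith
    positivity
  gcongr

/-- The generator acts on the initial state while the weight sits on the final one, so the triangle
inequality suffices. -/
theorem tsum_gen_le {N M : ℕ} (ν : Fin M → State N) (a : Fin M → State N → ℝ)
    (F : State N → State N → ℝ) (w : State N → ℝ) (hw : ∀ y, 0 ≤ w y) (B : State N → ℝ)
    (hB0 : ∀ z, 0 ≤ B z)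
    (hB : ∀ z, ∑' y, ENNReal.ofReal (w y * |F z y|) ≤ ENNReal.ofReal (B z)) (x : State N) :
    ∑' y, ENNReal.ofReal (w y * |gen ν a (fun z => F z y) x|)
      ≤ ENNReal.ofReal (∑ j, |a j x| * (B (x + ν j) + B x)) := by
  have hp : ∀ y, w y * |gen ν a (fun z => F z y) x|
      ≤ ∑ j, |a j x| * (w y * |F (x + ν j) y| + w y * |F x y|) := by
    intro y
    refine (mul_le_mul_of_nonneg_left (Finset.abs_sum_le_sum_abs _ _) (hw y)).trans ?_
    rw [Finset.mul_sum]
    refine Finset.sum_le_sum fun j _ => ?_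
    rw [abs_mul, mul_left_comm, ← mul_add]
    gcongr
    · exact hw y
    · exact abs_sub _ _
  have h0 : ∀ z y, 0 ≤ w y * |F z y| := fun z y => mul_nonneg (hw y) (abs_nonneg _)
  calc _ ≤ ∑' y, ∑ j, ENNReal.ofReal |a j x| *
        (ENNReal.ofReal (w y * |F (x + ν j) y|) + ENNReal.ofReal (w y * |F x y|)) := by
        refine ENNReal.tsum_le_tsum fun y => (ENNReal.ofReal_le_ofReal (hp y)).trans ?_
        rw [ENNReal.ofReal_sum_of_nonneg fun j _ => mul_nonneg (abs_nonneg _)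
          (add_nonneg (h0 _ _) (h0 _ _))]
        refine Finset.sum_le_sum fun j _ => ?_
        rw [ENNReal.ofReal_mul (abs_nonneg _), ENNReal.ofReal_add (h0 _ _) (h0 _ _)]
    _ = ∑ j, ENNReal.ofReal |a j x| * (∑' y, ENNReal.ofReal (w y * |F (x + ν j) y|)
          + ∑' y, ENNReal.ofReal (w y * |F x y|)) := by
        rw [Summable.tsum_finsetSum fun _ _ => ENNReal.summable]
        refine Finset.sum_congr rfl fun j _ => ?_
        rw [ENNReal.tsum_mul_left, ENNReal.tsum_add]
    _ ≤ ∑ j, ENNReal.ofReal |a j x| * (ENNReal.ofReal (B (x + ν j)) + ENNReal.ofReal (B x)) := by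
        gcongr
        · exact hB _
        · exact hB _
    _ = _ := by
        rw [ENNReal.ofReal_sum_of_nonneg fun j _ => mul_nonneg (abs_nonneg _)
          (add_nonneg (hB0 _) (hB0 _))]
        refine Finset.sum_congr rfl fun j _ => ?_
        rw [ENNReal.ofReal_mul (abs_nonneg _), ENNReal.ofReal_add (hB0 _) (hB0 _)]

theorem IsChemicalProcess.exists_derivBound {N M : ℕ} {ν : Fin M → State N}
    {a : Fin M → State N → ℝ} {Ω : Type*} [MeasurableSpace Ω] {X : ℝ≥0 → Ω → State N}
    {Pr : State N → Measure Ω} (hX : IsChemicalProcess ν a X Pr)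
    {nrm : Seminorm ℝ (Fin N → ℝ)} (h1 : PolyGrowth nrm a) {r : ℕ} {lam : ℝ}
    (h2 : ∀ τ, 0 < τ → MomGrowth nrm (transition X Pr) r lam τ) (k : ℕ) :
    ∃ H > 0, ∃ s > 0, ∀ τ, 0 < τ → DerivBound nrm k (transition X Pr) r H s lam τ := by
  induction k with
  | zero =>
    -- The degree `r + 1` instead of `r` keeps the exponent positive when `r = 0`.
    refine ⟨2, two_pos, r + 1, r.succ_pos, fun τ hτ x => ?_⟩
    have := h2 τ hτ x
    simp only [hX.timeDeriv_transition 0 x _ hτ.le, Function.iterate_zero, id]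
    simp only [abs_of_nonneg (transition_nonneg (X := X) (Pr := Pr) τ x _)]
    refine this.trans (ENNReal.ofReal_le_ofReal ?_)
    have h3 := pow_le_pow_add_one (absv_nonneg nrm x) (Nat.le_add_right r 1)
    have h4 := pow_nonneg (absv_nonneg nrm x) (r + 1)
    gcongr
    linarith
  | succ k ih =>
    obtain ⟨H, hH, s, hs, hb⟩ := ih
    obtain ⟨p, hp⟩ := h1
    choose α hα hap using hp
    set b : Fin M → ℝ := fun j => 2 ^ s * (1 + absv nrm (ν j) ^ s) + 1 with hbdef
    have hb0 : ∀ j, 0 ≤ b j := fun j => by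
      have := absv_nonneg nrm (ν j)
      positivity
    -- The 3 comes from multiplying two polynomial weights, and `b j` from shifting the weight by `ν
    -- j`. The final `+ 1` keeps the constant positive when there are no channels.
    refine ⟨∑ j, 3 * (α j * (H * (b j + 1))) + 1, ?_, p + s, by omega, fun τ hτ x => ?_⟩
    · have : 0 ≤ ∑ j, 3 * (α j * (H * (b j + 1))) := Finset.sum_nonneg fun j _ => by
        have := hb0 j
        have := hα j
        positivity
      linarith
    · simp only [hX.timeDeriv_transition (k + 1) x _ hτ.le, Function.iterate_succ_apply']
      have hw : ∀ y, 0 ≤ 1 + absv nrm y ^ r := fun y => by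
        have := absv_nonneg nrm y
        positivity
      have hB0 : ∀ z, 0 ≤ H * (absv nrm z ^ s + 1) * Real.exp (lam * τ) := fun z => by
        have := absv_nonneg nrm z
        positivity
      have hB : ∀ z, ∑' y, ENNReal.ofReal ((1 + absv nrm y ^ r) *
          |(gen ν a)^[k] (fun z => transition X Pr τ z y) z|)
          ≤ ENNReal.ofReal (H * (absv nrm z ^ s + 1) * Real.exp (lam * τ)) := fun z => by
        have := hb τ hτ z
        simpa only [hX.timeDeriv_transition k z _ hτ.le] using this
      refine (tsum_gen_le ν a (fun z y => (gen ν a)^[k] (fun z => transition X Pr τ z y) z) _ hw _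
        hB0 hB x).trans (ENNReal.ofReal_le_ofReal ?_)
      have hx := absv_nonneg nrm x
      set u := absv nrm x with hu
      calc _ ≤ ∑ j, 3 * (α j * (H * (b j + 1))) * (u ^ (p + s) + 1) * Real.exp (lam * τ) := by
            refine Finset.sum_le_sum fun j _ => ?_
            have e1 := absv_add_pow_le nrm x (ν j) s
            rw [← hu] at e1
            have e2 := pow_add_one_mul_le hx p s
            have e3 := hap j x
            rw [← hu] at e3
            have hαj := (hα j).le
            have hbj := hb0 j
            calc |a j x| * (H * (absv nrm (x + ν j) ^ s + 1) * Real.exp (lam * τ)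
                  + H * (u ^ s + 1) * Real.exp (lam * τ))
                = |a j x| * (H * ((absv nrm (x + ν j) ^ s + 1) + (u ^ s + 1)))
                  * Real.exp (lam * τ) := by ring
              _ ≤ (α j * (u ^ p + 1)) * (H * (b j * (u ^ s + 1) + (u ^ s + 1)))
                  * Real.exp (lam * τ) := by
                have := absv_nonneg nrm (x + ν j)
                gcongr
              _ = (α j * (H * (b j + 1))) * ((u ^ p + 1) * (u ^ s + 1))
                  * Real.exp (lam * τ) := by ring
              _ ≤ (α j * (H * (b j + 1))) * (3 * (u ^ (p + s) + 1))
                  * Real.exp (lam * τ) := by gcongr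
              _ = _ := by ring
        _ = (∑ j, 3 * (α j * (H * (b j + 1)))) * (u ^ (p + s) + 1) * Real.exp (lam * τ) := by
            rw [Finset.sum_mul, Finset.sum_mul]
        _ ≤ _ := by
            gcongr
            linarith

/-! ### The local error -/

/-- On a finite index set, freezing the signs of `f i τ` turns the weighted ℓ¹ norm at `τ` into the
value of one differentiable scalar function. The mean value theorem then gives a single time `c` at
which the bound on the derivatives is used. -/
theorem tsum_abs_le_of_deriv {ι : Type*} (w : ι → ℝ) (hw : ∀ i, 0 ≤ w i) (f f' : ι → ℝ → ℝ)
    (h0 : ∀ i, f i 0 = 0)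
    (hd : ∀ i t, 0 ≤ t → HasDerivWithinAt (f i) (f' i t) (Ici 0) t) {τ B : ℝ} (hτ : 0 < τ)
    (hB0 : 0 ≤ B)
    (hB : ∀ t ∈ Ioo 0 τ, ∑' i, ENNReal.ofReal (w i * |f' i t|) ≤ ENNReal.ofReal B) :
    ∑' i, ENNReal.ofReal (w i * |f i τ|) ≤ ENNReal.ofReal (B * τ) := by
  rw [ENNReal.tsum_eq_iSup_sum]
  refine iSup_le fun S => ?_
  rw [← ENNReal.ofReal_sum_of_nonneg fun i _ => mul_nonneg (hw i) (abs_nonneg _)]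
  refine ENNReal.ofReal_le_ofReal ?_
  set σ : ι → ℝ := fun i => (SignType.sign (f i τ) : ℝ) with hσ
  obtain ⟨c, hc, hceq⟩ := exists_hasDerivAt_eq_slope
    (fun t => ∑ i ∈ S, w i * σ i * f i t) (fun t => ∑ i ∈ S, w i * σ i * f' i t) hτ
    (continuousOn_finsetSum _ fun i _ => continuousOn_const.mul fun t ht =>
      ((hd i t ht.1).continuousWithinAt.mono fun u hu => hu.1))
    (fun t ht => HasDerivAt.fun_sum fun i _ =>
      ((hd i t ht.1.le).hasDerivAt (Ici_mem_nhds ht.1)).const_mul _)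
  have h1 : ∑ i ∈ S, w i * |f i τ| = (∑ i ∈ S, w i * σ i * f' i c) * τ := by
    rw [hceq]
    simp only [h0, mul_zero, Finset.sum_const_zero, sub_zero]
    rw [div_mul_cancel₀ _ hτ.ne']
    refine Finset.sum_congr rfl fun i _ => ?_
    rw [mul_assoc, hσ, sign_mul_self]
  rw [h1]
  gcongr
  have h2 : ∑ i ∈ S, w i * σ i * f' i c ≤ ∑ i ∈ S, w i * |f' i c| := by
    refine Finset.sum_le_sum fun i _ => ?_
    rw [mul_assoc]
    refine mul_le_mul_of_nonneg_left ((le_abs_self _).trans ?_) (hw i)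
    rw [abs_mul]
    refine mul_le_of_le_one_left (abs_nonneg _) ?_
    rcases SignType.trichotomy (SignType.sign (f i τ)) with h | h | h <;> simp [hσ, h]
  refine h2.trans ((ENNReal.ofReal_le_ofReal_iff hB0).1 ?_)
  rw [ENNReal.ofReal_sum_of_nonneg fun i _ => mul_nonneg (hw i) (abs_nonneg _)]
  exact (ENNReal.sum_le_tsum S).trans (hB c hc)

/-- Weighted row sums control the operator norm, by Tonelli. -/
theorem momVar_matApply_le {N : ℕ} (nrm : Seminorm ℝ (Fin N → ℝ)) {r r' : ℕ}
    {ψ : State N → State N → ℝ} {c : ℝ} (hc : 0 ≤ c)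
    (h : ∀ x, ∑' y, ENNReal.ofReal ((1 + absv nrm y ^ r) * |ψ x y|)
      ≤ ENNReal.ofReal (c * (1 + absv nrm x ^ r'))) (g : State N → ℝ) :
    momVar nrm r (matApply ψ g) ≤ ENNReal.ofReal c * momVar nrm r' g := by
  have hw : ∀ (r : ℕ) y, 0 ≤ 1 + absv nrm y ^ r := fun r y => by
    have := absv_nonneg nrm y
    positivity
  calc momVar nrm r (matApply ψ g)
      ≤ ∑' y, ∑' x, ENNReal.ofReal ((1 + absv nrm y ^ r) * |ψ x y|)
          * ENNReal.ofReal (1 / 2 * |g x|) := by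
        refine ENNReal.tsum_le_tsum fun y => ?_
        have h1 : ENNReal.ofReal |matApply ψ g y| ≤ ∑' x, ENNReal.ofReal (|ψ x y| * |g x|) := by
          simp only [← abs_mul, ← Real.enorm_eq_ofReal_abs]
          exact enorm_tsum_le_tsum_enorm
        rw [ENNReal.ofReal_mul (mul_nonneg (by norm_num) (hw r y))]
        refine (mul_le_mul_right h1 _).trans (le_of_eq ?_)
        rw [← ENNReal.tsum_mul_left]
        refine tsum_congr fun x => ?_
        rw [← ENNReal.ofReal_mul (mul_nonneg (by norm_num) (hw r y)),
          ← ENNReal.ofReal_mul (mul_nonneg (hw r y) (abs_nonneg _))]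
        congr 1
        ring
    _ = ∑' x, (∑' y, ENNReal.ofReal ((1 + absv nrm y ^ r) * |ψ x y|))
          * ENNReal.ofReal (1 / 2 * |g x|) := by
        rw [ENNReal.tsum_comm]
        simp only [ENNReal.tsum_mul_right]
    _ ≤ ∑' x, ENNReal.ofReal (c * (1 + absv nrm x ^ r')) * ENNReal.ofReal (1 / 2 * |g x|) := by
        gcongr with x
        exact h x
    _ = _ := by
        rw [momVar, ← ENNReal.tsum_mul_left]
        refine tsum_congr fun x => ?_
        rw [← ENNReal.ofReal_mul (mul_nonneg hc (hw r' x)), ← ENNReal.ofReal_mul hc]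
        congr 1
        ring

theorem hasDerivWithinAt_timeDeriv {N : ℕ} {ψ : ℝ → State N → State N → ℝ} {x y : State N}
    {n k : ℕ} (h : ContDiffOn ℝ (n : WithTop ℕ∞) (fun u => ψ u x y) (Ici 0)) (hk : k < n) {t : ℝ}
    (ht : 0 ≤ t) :
    HasDerivWithinAt (fun u => timeDeriv k ψ u x y) (timeDeriv (k + 1) ψ t x y) (Ici 0) t := by
  have h1 := h.differentiableOn_iteratedDerivWithin (m := k) (by exact_mod_cast hk)
    (uniqueDiffOn_Ici 0) t ht
  have h2 := h1.hasDerivWithinAt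
  rwa [← iteratedDerivWithin_succ] at h2

/-- Descent on the order of the derivative. At order `q + 1` the bounds (a) and (b) are added; each
lower order vanishes at 0 by consistency and gains one factor `τ`. -/
theorem tsum_localError_le {N : ℕ} {nrm : Seminorm ℝ (Fin N → ℝ)}
    {φ P : ℝ → State N → State N → ℝ} {q r s : ℕ} {H γ δ : ℝ} (hH : 0 < H) (hγ : 0 < γ)
    (hP : ∀ x y, ContDiffOn ℝ ((q + 1 : ℕ) : WithTop ℕ∞) (fun u => P u x y) (Ici 0))
    (h3 : PointwiseConsistent q φ P)
    (ha : ∀ τ, 0 ≤ τ → τ < δ → DerivBound nrm (q + 1) φ r H s γ τ)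
    (hb : ∀ τ, 0 < τ → DerivBound nrm (q + 1) P r H s γ τ) (x : State N) (m : ℕ)
    (hm : m ≤ q + 1) {τ : ℝ} (hτ : 0 < τ) (hτδ : τ < δ) :
    ∑' y, ENNReal.ofReal ((1 + absv nrm y ^ r)
        * |timeDeriv (q + 1 - m) φ τ x y - timeDeriv (q + 1 - m) P τ x y|)
      ≤ ENNReal.ofReal (2 * (H * (absv nrm x ^ s + 1)) * (τ ^ m * Real.exp (γ * τ))) := by
  have hw : ∀ y, 0 ≤ 1 + absv nrm y ^ r := fun y => by
    have := absv_nonneg nrm y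
    positivity
  have hx := absv_nonneg nrm x
  induction m generalizing τ with
  | zero =>
    have hK : 0 ≤ H * (absv nrm x ^ s + 1) * Real.exp (γ * τ) := by positivity
    calc _ ≤ ∑' y, (ENNReal.ofReal ((1 + absv nrm y ^ r) * |timeDeriv (q + 1) φ τ x y|)
          + ENNReal.ofReal ((1 + absv nrm y ^ r) * |timeDeriv (q + 1) P τ x y|)) := by
          refine ENNReal.tsum_le_tsum fun y => ?_
          rw [← ENNReal.ofReal_add (mul_nonneg (hw y) (abs_nonneg _))
            (mul_nonneg (hw y) (abs_nonneg _)), ← mul_add]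
          exact ENNReal.ofReal_le_ofReal (mul_le_mul_of_nonneg_left (abs_sub _ _) (hw y))
      _ ≤ _ := by
          rw [ENNReal.tsum_add]
          refine (add_le_add (ha τ hτ.le hτδ x) (hb τ hτ x)).trans ?_
          rw [← ENNReal.ofReal_add hK hK]
          refine ENNReal.ofReal_le_ofReal (le_of_eq ?_)
          ring
  | succ m ih =>
    have hk : q + 1 - m = (q + 1 - (m + 1)) + 1 := by omega
    have h1 := tsum_abs_le_of_deriv (fun y => 1 + absv nrm y ^ r) hw
      (fun y t => timeDeriv (q + 1 - (m + 1)) φ t x y - timeDeriv (q + 1 - (m + 1)) P t x y)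
      (fun y t => timeDeriv (q + 1 - m) φ t x y - timeDeriv (q + 1 - m) P t x y)
      (fun y => sub_eq_zero.2 ((h3 x y).2 _ (by omega)))
      (fun y t ht => by
        rw [hk]
        exact (hasDerivWithinAt_timeDeriv (h3 x y).1 (by omega) ht).sub
          (hasDerivWithinAt_timeDeriv (hP x y) (by omega) ht)) hτ
      (B := 2 * (H * (absv nrm x ^ s + 1)) * (τ ^ m * Real.exp (γ * τ))) (by positivity)
      (fun t ht => by
        refine (ih (by omega) ht.1 (ht.2.trans hτδ)).trans (ENNReal.ofReal_le_ofReal ?_)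
        have := ht.1.le
        have := ht.2.le
        gcongr)
    refine h1.trans (ENNReal.ofReal_le_ofReal (le_of_eq ?_))
    ring

theorem localErrorBound_of_derivBound {N : ℕ} {nrm : Seminorm ℝ (Fin N → ℝ)}
    {φ P : ℝ → State N → State N → ℝ} {q r s : ℕ} {H γ δ : ℝ} (hH : 0 < H) (hγ : 0 < γ)
    (hP : ∀ x y, ContDiffOn ℝ ((q + 1 : ℕ) : WithTop ℕ∞) (fun u => P u x y) (Ici 0))
    (h3 : PointwiseConsistent q φ P)
    (ha : ∀ τ, 0 ≤ τ → τ < δ → DerivBound nrm (q + 1) φ r H s γ τ)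
    (hb : ∀ τ, 0 < τ → DerivBound nrm (q + 1) P r H s γ τ) :
    LocalErrorBound nrm q φ P r s γ δ (4 * H) := by
  intro τ hτ hτδ g _
  have hc : 0 ≤ τ ^ (q + 1) * Real.exp (γ * τ) := by positivity
  -- In `4 * H`, one factor 2 comes from adding (a) and (b), the other from `u ^ s + 1 ≤ 2 * (1 + u
  -- ^ (s + r))`.
  rw [mul_right_comm, ← ENNReal.ofReal_mul (by positivity)]
  refine momVar_matApply_le nrm (by positivity) (fun x => ?_) g
  have hx := absv_nonneg nrm x
  rcases hτ.eq_or_lt with rfl | hτ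
  · have h0 : ∀ y, φ 0 x y - P 0 x y = 0 := fun y => by
      have := (h3 x y).2 0 (Nat.zero_le q)
      simp only [timeDeriv, iteratedDerivWithin_zero] at this
      exact sub_eq_zero.2 this
    simp [h0]
  · have h1 := tsum_localError_le hH hγ hP h3 ha hb x (q + 1) le_rfl hτ hτδ
    simp only [Nat.sub_self, timeDeriv, iteratedDerivWithin_zero] at h1
    refine h1.trans (ENNReal.ofReal_le_ofReal ?_)
    have h2 := pow_add_one_le_two_mul hx s r
    calc 2 * (H * (absv nrm x ^ s + 1)) * (τ ^ (q + 1) * Real.exp (γ * τ))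
        ≤ 2 * (H * (2 * (1 + absv nrm x ^ (s + r)))) * (τ ^ (q + 1) * Real.exp (γ * τ)) := by
          gcongr
      _ = _ := by ring

section

variable {N : ℕ}

/-! ### Moment variations and expectations -/

theorem momVar_add_le (nrm : Seminorm ℝ (Fin N → ℝ)) (r : ℕ) (f g : State N → ℝ) :
    momVar nrm r (f + g) ≤ momVar nrm r f + momVar nrm r g := by
  rw [momVar, momVar, momVar, ← ENNReal.tsum_add]
  refine ENNReal.tsum_le_tsum fun x => ?_
  have hw : 0 ≤ 1 / 2 * (1 + absv nrm x ^ r) := by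
    have := absv_nonneg nrm x
    positivity
  rw [← ENNReal.ofReal_add (mul_nonneg hw (abs_nonneg _)) (mul_nonneg hw (abs_nonneg _)),
    ← mul_add]
  exact ENNReal.ofReal_le_ofReal (mul_le_mul_of_nonneg_left (abs_add_le _ _) hw)

theorem summable_of_momVar_lt_top {nrm : Seminorm ℝ (Fin N → ℝ)} {r : ℕ} {g : State N → ℝ}
    (hg : momVar nrm r g < ∞) : Summable fun x => absv nrm x ^ r * g x := by
  have hw : ∀ x, 0 ≤ 1 / 2 * (1 + absv nrm x ^ r) * |g x| := fun x => by
    have := absv_nonneg nrm x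
    positivity
  have h1 : Summable fun x => 1 / 2 * (1 + absv nrm x ^ r) * |g x| := by
    refine (ENNReal.summable_toReal hg.ne).congr fun x => ?_
    rw [ENNReal.toReal_ofReal (hw x)]
  refine Summable.of_norm_bounded (h1.mul_left 2) fun x => ?_
  have hx := pow_nonneg (absv_nonneg nrm x) r
  rw [Real.norm_eq_abs, abs_mul, abs_of_nonneg hx]
  nlinarith [abs_nonneg (g x)]

theorem ofReal_abs_tsum_le (nrm : Seminorm ℝ (Fin N → ℝ)) (r : ℕ) (g : State N → ℝ) :
    ENNReal.ofReal |∑' x, absv nrm x ^ r * g x| ≤ 2 * momVar nrm r g := by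
  rw [← Real.enorm_eq_ofReal_abs, momVar, ← ENNReal.tsum_mul_left]
  refine enorm_tsum_le_tsum_enorm.trans (ENNReal.tsum_le_tsum fun x => ?_)
  have hx := pow_nonneg (absv_nonneg nrm x) r
  rw [Real.enorm_eq_ofReal_abs, abs_mul, abs_of_nonneg hx, ← ENNReal.ofReal_ofNat 2,
    ← ENNReal.ofReal_mul (by norm_num)]
  refine ENNReal.ofReal_le_ofReal ?_
  nlinarith [abs_nonneg (g x)]

theorem IsProb.momVar_eq {nrm : Seminorm ℝ (Fin N → ℝ)} {r : ℕ} {p : State N → ℝ}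
    (hp : IsProb p) (hr : momVar nrm r p < ∞) :
    momVar nrm r p = ENNReal.ofReal (1 / 2 * (1 + ∑' x, absv nrm x ^ r * p x)) := by
  have h1 := ((hp.2.add (summable_of_momVar_lt_top hr).hasSum).mul_left (1 / 2))
  have h2 : ∀ x, 1 / 2 * (p x + absv nrm x ^ r * p x) = 1 / 2 * (1 + absv nrm x ^ r) * |p x| := by
    intro x
    rw [abs_of_nonneg (hp.1 x)]
    ring
  simp only [h2] at h1
  rw [← h1.tsum_eq, ENNReal.ofReal_tsum_of_nonneg _ h1.summable, momVar]
  intro x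
  have := absv_nonneg nrm x
  positivity

theorem integrable_absv_pow {Ω : Type*} [MeasurableSpace Ω] {μ : Measure Ω} {Z : Ω → State N}
    (hZ : Measurable Z) {p : State N → ℝ} (hp : ∀ x, 0 ≤ p x)
    (h : ∀ x, μ {ω | Z ω = x} = ENNReal.ofReal (p x)) {nrm : Seminorm ℝ (Fin N → ℝ)} {r : ℕ}
    (hr : momVar nrm r p < ∞) :
    Integrable (fun ω => absv nrm (Z ω) ^ r) μ ∧
      ∫ ω, absv nrm (Z ω) ^ r ∂μ = ∑' x, absv nrm x ^ r * p x := by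
  have hmap : ∀ x, μ.map Z {x} = ENNReal.ofReal (p x) := fun x => by
    rw [Measure.map_apply hZ (measurableSet_singleton x), ← h x]
    rfl
  have hsm : StronglyMeasurable fun x : State N => absv nrm x ^ r :=
    (measurable_of_countable _).stronglyMeasurable
  have hI : Integrable (fun x : State N => absv nrm x ^ r) (μ.map Z) := by
    refine ⟨hsm.aestronglyMeasurable, ?_⟩
    rw [HasFiniteIntegral, lintegral_countable']
    have h0 : ∀ x, 0 ≤ absv nrm x ^ r := fun x => pow_nonneg (absv_nonneg nrm x) r
    simp only [hmap, Real.enorm_eq_ofReal (h0 _), ← ENNReal.ofReal_mul (h0 _)]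
    rw [← ENNReal.ofReal_tsum_of_nonneg (fun x => mul_nonneg (h0 x) (hp x))
      (summable_of_momVar_lt_top hr)]
    exact ENNReal.ofReal_lt_top
  refine ⟨(integrable_map_measure hsm.aestronglyMeasurable hZ.aemeasurable).1 hI, ?_⟩
  rw [← integral_map hZ.aemeasurable hsm.aestronglyMeasurable
    (f := fun x : State N => absv nrm x ^ r), integral_countable hI]
  refine tsum_congr fun x => ?_
  rw [measureReal_def, hmap, ENNReal.toReal_ofReal (hp x), smul_eq_mul, mul_comm]

/-! ### Stochastic matrices -/

theorem IsProb.le_one {p : State N → ℝ} (hp : IsProb p) (x : State N) : p x ≤ 1 :=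
  le_hasSum hp.2 x fun y _ => hp.1 y

theorem summable_matApply {ψ : State N → State N → ℝ} (hψ : ∀ x, IsProb (ψ x)) {g : State N → ℝ}
    (hg : Summable g) (y : State N) : Summable fun x => ψ x y * g x := by
  refine Summable.of_norm_bounded hg.norm fun x => ?_
  rw [norm_mul, Real.norm_of_nonneg ((hψ x).1 y)]
  exact mul_le_of_le_one_left (norm_nonneg _) ((hψ x).le_one y)

theorem ofReal_matApply {ψ : State N → State N → ℝ} (hψ : ∀ x, IsProb (ψ x)) {g : State N → ℝ}
    (hg0 : ∀ x, 0 ≤ g x) (hg : Summable g) (y : State N) :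
    ENNReal.ofReal (matApply ψ g y) = ∑' x, ENNReal.ofReal (ψ x y) * ENNReal.ofReal (g x) := by
  rw [matApply, ENNReal.ofReal_tsum_of_nonneg (fun x => mul_nonneg ((hψ x).1 y) (hg0 x))
    (summable_matApply hψ hg y)]
  exact tsum_congr fun x => ENNReal.ofReal_mul ((hψ x).1 y)

theorem IsProb.matApply {ψ : State N → State N → ℝ} (hψ : ∀ x, IsProb (ψ x)) {p : State N → ℝ}
    (hp : IsProb p) : IsProb (matApply ψ p) := by
  refine ⟨fun y => tsum_nonneg fun x => mul_nonneg ((hψ x).1 y) (hp.1 x), ?_⟩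
  have h1 : ∀ p : State N → ℝ, IsProb p → ∑' y, ENNReal.ofReal (p y) = 1 := fun p hp => by
    rw [← ENNReal.ofReal_tsum_of_nonneg hp.1 hp.2.summable, hp.2.tsum_eq, ENNReal.ofReal_one]
  refine hasSum_of_tsum_ofReal
    (fun y => tsum_nonneg fun x => mul_nonneg ((hψ x).1 y) (hp.1 x)) zero_le_one ?_
  simp only [ofReal_matApply hψ hp.1 hp.2.summable]
  rw [ENNReal.tsum_comm, ENNReal.ofReal_one, ← h1 p hp]
  refine tsum_congr fun x => ?_
  rw [ENNReal.tsum_mul_right, h1 _ (hψ x), one_mul]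

/-- With `ψ` the tau leap matrix and `χ` the exact one, this splits the new error into the
propagated old error and the local error at the exact law `h`. -/
theorem matApply_sub_matApply {ψ χ : State N → State N → ℝ} (hψ : ∀ x, IsProb (ψ x))
    (hχ : ∀ x, IsProb (χ x)) {g h : State N → ℝ} (hg : Summable g) (hh : Summable h) :
    matApply ψ g - matApply χ h
      = matApply ψ (g - h) + matApply (fun x y => ψ x y - χ x y) h := by
  ext y
  have h1 := summable_matApply hψ hg y
  have h2 := summable_matApply hψ hh y
  have h3 := summable_matApply hχ hh y
  simp only [matApply, Pi.sub_apply, Pi.add_apply, mul_sub, sub_mul]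
  rw [h1.tsum_sub h2, h2.tsum_sub h3]
  ring

/-! ### The law of the chemical process -/

section Transition

variable {M : ℕ} {ν : Fin M → State N} {a : Fin M → State N → ℝ}
  {Ω : Type*} [MeasurableSpace Ω] {X : ℝ≥0 → Ω → State N} {Pr : State N → Measure Ω}

theorem IsChemicalProcess.initLaw_apply (hX : IsChemicalProcess ν a X Pr) {p₀ : State N → ℝ}
    (hp : IsProb p₀) (t : ℝ≥0) (y : State N) :
    initLaw Pr p₀ {ω | X t ω = y} = ENNReal.ofReal (matApply (transition X Pr t) p₀ y) := by
  rw [ofReal_matApply (hX.isProb_transition t) hp.1 hp.2.summable, initLaw,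
    Measure.sum_apply _ (hX.measurableSet_fiber t y)]
  refine tsum_congr fun x => ?_
  rw [hX.ofReal_transition, Real.toNNReal_coe, Measure.smul_apply, smul_eq_mul, mul_comm]

theorem IsChemicalProcess.matApply_transition_zero (hX : IsChemicalProcess ν a X Pr)
    (g : State N → ℝ) : matApply (transition X Pr 0) g = g := by
  ext y
  simp [matApply, hX.transition_zero]

theorem IsChemicalProcess.matApply_transition_add (hX : IsChemicalProcess ν a X Pr)
    {s t : ℝ} (hs : 0 ≤ s) (ht : 0 ≤ t) {p : State N → ℝ} (hp : IsProb p) :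
    matApply (transition X Pr (s + t)) p
      = matApply (transition X Pr t) (matApply (transition X Pr s) p) := by
  have hp' := IsProb.matApply (hX.isProb_transition s) hp
  ext y
  rw [← ENNReal.ofReal_eq_ofReal_iff
    ((IsProb.matApply (hX.isProb_transition (s + t)) hp).1 y)
    ((IsProb.matApply (hX.isProb_transition t) hp').1 y),
    ofReal_matApply (hX.isProb_transition (s + t)) hp.1 hp.2.summable,
    ofReal_matApply (hX.isProb_transition t) hp'.1 hp'.2.summable]
  simp only [ofReal_matApply (hX.isProb_transition s) hp.1 hp.2.summable,
    ← ENNReal.tsum_mul_left]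
  rw [ENNReal.tsum_comm]
  refine tsum_congr fun x => ?_
  have h1 := hX.hasSum_transition_mul hs ht x y
  rw [← h1.tsum_eq, ENNReal.ofReal_tsum_of_nonneg (fun z => mul_nonneg
    (transition_nonneg _ _ _) (transition_nonneg _ _ _)) h1.summable, ← ENNReal.tsum_mul_right]
  refine tsum_congr fun z => ?_
  rw [ENNReal.ofReal_mul (transition_nonneg _ _ _)]
  ring

theorem MomGrowth.momVar_matApply_le {nrm : Seminorm ℝ (Fin N → ℝ)}
    {ψ : ℝ → State N → State N → ℝ} {r : ℕ} {lam τ : ℝ} (h : MomGrowth nrm ψ r lam τ)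
    (hψ : ∀ x, IsProb (ψ τ x)) (g : State N → ℝ) :
    momVar nrm r (matApply (ψ τ) g) ≤ ENNReal.ofReal (Real.exp (lam * τ)) * momVar nrm r g := by
  refine TauLeap.momVar_matApply_le nrm (Real.exp_pos _).le (fun x => ?_) g
  have := h x
  simp only [abs_of_nonneg ((hψ x).1 _)]
  rwa [mul_comm (Real.exp _)]

theorem IsChemicalProcess.momVar_law_le (hX : IsChemicalProcess ν a X Pr)
    {nrm : Seminorm ℝ (Fin N → ℝ)} {r : ℕ} {lam : ℝ}
    (h2 : ∀ τ, 0 < τ → MomGrowth nrm (transition X Pr) r lam τ) {t : ℝ} (ht : 0 ≤ t)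
    (g : State N → ℝ) :
    momVar nrm r (matApply (transition X Pr t) g)
      ≤ ENNReal.ofReal (Real.exp (lam * t)) * momVar nrm r g := by
  rcases ht.eq_or_lt with rfl | ht
  · rw [hX.matApply_transition_zero]
    simp
  · exact (h2 t ht).momVar_matApply_le (hX.isProb_transition t) g

end Transition

/-! ### The law of the tau leap solution -/

theorem Mesh.t_le {T : ℝ≥0} (π : Mesh T) (j : Fin (π.n + 1)) : π.t j ≤ T :=
  (π.strictMono.monotone (Fin.le_last j)).trans_eq π.last

theorem Mesh.step_pos {T : ℝ≥0} (π : Mesh T) (j : Fin π.n) : 0 < π.step j :=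
  sub_pos.2 (NNReal.coe_lt_coe.2 (π.strictMono Fin.castSucc_lt_succ))

theorem Mesh.step_le_size {T : ℝ≥0} (π : Mesh T) (j : Fin π.n) : π.step j ≤ π.size :=
  le_ciSup (Set.finite_range π.step).bddAbove j

theorem Mesh.t_succ {T : ℝ≥0} (π : Mesh T) (j : Fin π.n) :
    (π.t j.succ : ℝ) = π.t j.castSucc + π.step j := by
  rw [Mesh.step]
  ring

theorem Mesh.size_nonneg {T : ℝ≥0} (π : Mesh T) : 0 ≤ π.size :=
  Real.iSup_nonneg fun j => (π.step_pos j).le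

theorem IsTauLeapSolution.law_succ {φ : ℝ → State N → State N → ℝ} {T : ℝ≥0} {π : Mesh T}
    {p₀ : State N → ℝ} {Ω : Type*} [MeasurableSpace Ω] {μ : Measure Ω} [IsProbabilityMeasure μ]
    {Y : ℝ≥0 → Ω → State N} (hY : IsTauLeapSolution φ π p₀ μ Y) (j : Fin π.n) :
    (fun y => μ.real {ω | Y (π.t j.succ) ω = y})
      = matApply (φ (π.step j)) fun x => μ.real {ω | Y (π.t j.castSucc) ω = x} := by
  ext y
  have hm := hY.measurable _ (π.t_le j.castSucc)
  have hm' : MeasurableSet {ω | Y (π.t j.succ) ω = y} :=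
    hY.measurable _ (π.t_le j.succ) (measurableSet_singleton y)
  have h1 := tsum_measure_inter_fiber μ hm hm'
  have e : ∀ A, μ A = ENNReal.ofReal (μ.real A) := fun A => (ofReal_measureReal).symm
  simp only [e] at h1
  rw [← (hasSum_of_tsum_ofReal (fun _ => measureReal_nonneg) measureReal_nonneg h1).tsum_eq]
  refine tsum_congr fun x => ?_
  have hmx : MeasurableSet {ω | Y (π.t j.castSucc) ω = x} := hm (measurableSet_singleton x)
  -- Conditional probabilities are prescribed only at states of positive mass; at the others both
  -- terms vanish.
  by_cases h0 : μ {ω | Y (π.t j.castSucc) ω = x} = 0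
  · have h2 := measure_mono_null
      (inter_subset_left (t := {ω | Y (π.t j.succ) ω = y})) h0
    simp [measureReal_def, h0, h2]
  · rw [← hY.trans j x y h0, measureReal_def, measureReal_def, cond_apply hmx, ENNReal.toReal_mul,
      ENNReal.toReal_inv]
    simp only [measureReal_def]
    rw [mul_comm, mul_inv_cancel_left₀]
    exact ENNReal.toReal_ne_zero.2 ⟨h0, measure_ne_top _ _⟩

theorem IsTauLeapSolution.isProb_law {φ : ℝ → State N → State N → ℝ} {T : ℝ≥0} {π : Mesh T}
    {p₀ : State N → ℝ} {Ω : Type*} [MeasurableSpace Ω] {μ : Measure Ω} [IsProbabilityMeasure μ]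
    {Y : ℝ≥0 → Ω → State N} (hY : IsTauLeapSolution φ π p₀ μ Y) {t : ℝ≥0} (ht : t ≤ T) :
    IsProb fun y => μ.real {ω | Y t ω = y} := by
  refine ⟨fun _ => measureReal_nonneg,
    hasSum_of_tsum_ofReal (fun _ => measureReal_nonneg) zero_le_one ?_⟩
  have e : ∀ A, ENNReal.ofReal (μ.real A) = μ A := fun A => ofReal_measureReal
  simp only [e]
  have := tsum_measure_inter_fiber μ (hY.measurable t ht) MeasurableSet.univ
  simpa using this

/-- One step of a discrete Gronwall argument: `τ ^ (q + 1) ≤ h ^ q * τ`, and with every rate raised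
to `m` the factor `t` simply becomes `t + τ`. -/
theorem error_step_le {C l l' γ m t τ h : ℝ} {q : ℕ} (hC : 0 ≤ C) (ht : 0 ≤ t) (hτ : 0 ≤ τ)
    (hh : τ ≤ h) (h1 : l ≤ m) (h2 : l' ≤ m) (h3 : γ ≤ m) :
    Real.exp (l * τ) * (C * (Real.exp (m * t) * t * h ^ q))
        + C * Real.exp (l' * t) * (τ ^ (q + 1) * Real.exp (γ * τ))
      ≤ C * (Real.exp (m * (t + τ)) * (t + τ) * h ^ q) := by
  have hh0 : 0 ≤ h := hτ.trans hh
  calc _ ≤ Real.exp (m * τ) * (C * (Real.exp (m * t) * t * h ^ q))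
        + C * Real.exp (m * t) * ((h ^ q * τ) * Real.exp (m * τ)) := by
        rw [pow_succ]
        gcongr
    _ = _ := by
        rw [mul_add m, Real.exp_add]
        ring

theorem momVar_law_sub_le {M : ℕ} {ν : Fin M → State N} {a : Fin M → State N → ℝ}
    {Ω : Type*} [MeasurableSpace Ω] {X : ℝ≥0 → Ω → State N} {Pr : State N → Measure Ω}
    (hX : IsChemicalProcess ν a X Pr) {nrm : Seminorm ℝ (Fin N → ℝ)}
    {φ : ℝ → State N → State N → ℝ} (hφ : IsTauLeapMethod φ) {q r s : ℕ} {lam : ℕ → ℝ} {γ δ C : ℝ}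
    (h2 : ∀ r τ, 0 < τ → MomGrowth nrm (transition X Pr) r (lam r) τ)
    (h6 : ∀ τ, 0 ≤ τ → τ < δ → MomGrowth nrm φ r (lam r) τ) (hC : 0 ≤ C)
    (hloc : LocalErrorBound nrm q φ (transition X Pr) r s γ δ C) {T : ℝ≥0} {π : Mesh T}
    (hπ : π.size < δ) {p₀ : State N → ℝ} (hp : IsProb p₀) (hpM : MemM nrm p₀)
    {Ω' : Type*} [MeasurableSpace Ω'] {μ : Measure Ω'} [IsProbabilityMeasure μ]
    {Y : ℝ≥0 → Ω' → State N} (hY : IsTauLeapSolution φ π p₀ μ Y) (j : Fin (π.n + 1)) :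
    momVar nrm r ((fun y => μ.real {ω | Y (π.t j) ω = y}) - matApply (transition X Pr (π.t j)) p₀)
      ≤ ENNReal.ofReal (C * (Real.exp (max (lam r) (max (lam (s + r)) γ) * π.t j) * π.t j
          * π.size ^ q)) * momVar nrm (s + r) p₀ := by
  induction j using Fin.induction with
  | zero =>
    have h0 : (fun y => μ.real {ω | Y (π.t 0) ω = y}) - matApply (transition X Pr (π.t 0)) p₀
        = 0 := by
      rw [π.first, NNReal.coe_zero, hX.matApply_transition_zero, sub_eq_zero]
      exact funext hY.init
    rw [h0]
    simp [momVar]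
  | succ j ih =>
    have hτ := π.step_pos j
    have hτδ := (π.step_le_size j).trans_lt hπ
    have ht : (0 : ℝ) ≤ π.t j.castSucc := NNReal.coe_nonneg _
    have hlaw := hY.isProb_law (π.t_le j.castSucc)
    have hlawX := IsProb.matApply (hX.isProb_transition (π.t j.castSucc)) hp
    -- The local error bound is available only on `𝓜`, so the exact law must stay there.
    have hMX : MemM nrm (matApply (transition X Pr (π.t j.castSucc)) p₀) := fun r' =>
      (hX.momVar_law_le (h2 r') ht p₀).trans_lt (ENNReal.mul_lt_top ENNReal.ofReal_lt_top (hpM r'))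
    rw [hY.law_succ j, π.t_succ j, hX.matApply_transition_add ht hτ.le hp,
      matApply_sub_matApply (hφ _ hτ.le) (hX.isProb_transition _) hlaw.2.summable hlawX.2.summable]
    refine (momVar_add_le nrm r _ _).trans ?_
    refine (add_le_add ((h6 _ hτ.le hτδ).momVar_matApply_le (hφ _ hτ.le) _)
      (hloc _ hτ.le hτδ _ hMX)).trans ?_
    refine (add_le_add (mul_le_mul_right ih _) (mul_le_mul_left (mul_le_mul_right
      (hX.momVar_law_le (h2 (s + r)) ht p₀) _) _)).trans ?_
    have hsz := π.size_nonneg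
    rw [← mul_assoc, ← ENNReal.ofReal_mul (by positivity), ← mul_assoc (ENNReal.ofReal C),
      ← ENNReal.ofReal_mul (by positivity), mul_right_comm _ (momVar nrm (s + r) p₀),
      ← ENNReal.ofReal_mul (by positivity), ← add_mul, ← ENNReal.ofReal_add (by positivity) (by positivity)]
    gcongr
    exact error_step_le hC ht hτ.le (π.step_le_size j) (le_max_left _ _)
      ((le_max_left _ _).trans (le_max_right _ _)) ((le_max_right _ _).trans (le_max_right _ _))

end

end TauLeap

/-! ### Common constants for (a) and (b), and passage from laws to expectations. -/

theorem mainTheorem3 {N M : ℕ} (nrm : Seminorm ℝ (Fin N → ℝ)) (hnrm : ∀ v, nrm v = 0 → v = 0)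
    (ν : Fin M → TauLeap.State N) (a : Fin M → TauLeap.State N → ℝ)
    {Ω : Type*} [MeasurableSpace Ω]
    (X : ℝ≥0 → Ω → TauLeap.State N) (Pr : TauLeap.State N → Measure Ω)
    (hX : TauLeap.IsChemicalProcess ν a X Pr)
    (φ : ℝ → TauLeap.State N → TauLeap.State N → ℝ) (hφ : TauLeap.IsTauLeapMethod φ)
    (q : ℕ) (lam δ : ℕ → ℝ) (hlam : ∀ r, 0 < lam r) (hδ : ∀ r, 0 < δ r)
    (h1 : TauLeap.PolyGrowth nrm a)
    (h2 : ∀ r τ, 0 < τ → TauLeap.MomGrowth nrm (TauLeap.transition X Pr) r (lam r) τ)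
    (h3 : TauLeap.PointwiseConsistent q φ (TauLeap.transition X Pr))
    (h5 : ∀ r, ∃ H > 0, ∃ s > 0, ∃ γ > 0, ∀ τ, 0 ≤ τ → τ < δ r →
      TauLeap.DerivBound nrm (q + 1) φ r H s γ τ)
    (h6 : ∀ r τ, 0 ≤ τ → τ < δ r → TauLeap.MomGrowth nrm φ r (lam r) τ)
    (r : ℕ) :
    (∃ H > 0, ∃ s > 0, ∃ γ > 0,
      (∀ τ, 0 ≤ τ → τ < δ r → TauLeap.DerivBound nrm (q + 1) φ r H s γ τ) ∧
      (∀ τ, 0 < τ → TauLeap.DerivBound nrm (q + 1) (TauLeap.transition X Pr) r H s γ τ)) ∧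
    ∀ (H : ℝ) (s : ℕ) (γ : ℝ), 0 < H → 0 < s → 0 < γ →
      (∀ τ, 0 ≤ τ → τ < δ r → TauLeap.DerivBound nrm (q + 1) φ r H s γ τ) →
      (∀ τ, 0 < τ → TauLeap.DerivBound nrm (q + 1) (TauLeap.transition X Pr) r H s γ τ) →
      (∃ C > 0, TauLeap.LocalErrorBound nrm q φ (TauLeap.transition X Pr) r s γ (δ r) C) ∧
      ∀ C > 0, TauLeap.LocalErrorBound nrm q φ (TauLeap.transition X Pr) r s γ (δ r) C →
        ∀ (T : ℝ≥0) (π : TauLeap.Mesh T), 0 < T → π.size < δ r →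
        ∀ p₀ : TauLeap.State N → ℝ, TauLeap.IsProb p₀ → TauLeap.MemM nrm p₀ →
        ∀ {Ω' : Type*} [MeasurableSpace Ω'] (μ : Measure Ω') [IsProbabilityMeasure μ]
          (Y : ℝ≥0 → Ω' → TauLeap.State N), TauLeap.IsTauLeapSolution φ π p₀ μ Y →
        Integrable (fun ω => TauLeap.absv nrm (Y T ω) ^ r) μ ∧
        Integrable (fun ω => TauLeap.absv nrm (X T ω) ^ r) (TauLeap.initLaw Pr p₀) ∧
        Integrable (fun ω => TauLeap.absv nrm (X 0 ω) ^ (s + r)) (TauLeap.initLaw Pr p₀) ∧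
        |(∫ ω, TauLeap.absv nrm (Y T ω) ^ r ∂μ)
            - ∫ ω, TauLeap.absv nrm (X T ω) ^ r ∂(TauLeap.initLaw Pr p₀)|
          ≤ C * (1 + ∫ ω, TauLeap.absv nrm (X 0 ω) ^ (s + r) ∂(TauLeap.initLaw Pr p₀))
              * T * Real.exp (max (lam r) (max (lam (s + r)) γ) * T) * π.size ^ q ∧
        ((∀ x, p₀ x ≠ 0 → 1 ≤ TauLeap.absv nrm x) →
          |(∫ ω, TauLeap.absv nrm (Y T ω) ^ r ∂μ)
              - ∫ ω, TauLeap.absv nrm (X T ω) ^ r ∂(TauLeap.initLaw Pr p₀)|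
            ≤ 2 * C * (∫ ω, TauLeap.absv nrm (X 0 ω) ^ (s + r) ∂(TauLeap.initLaw Pr p₀))
                * T * Real.exp (max (lam r) (max (lam (s + r)) γ) * T) * π.size ^ q) := by
  refine ⟨?_, ?_⟩
  · obtain ⟨H, hH, s, hs, γ, hγ, ha⟩ := h5 r
    obtain ⟨H', hH', s', hs', hb⟩ := hX.exists_derivBound h1 (h2 r) (q + 1)
    refine ⟨2 * (H + H'), by positivity, s + s', by omega, max γ (lam r), lt_max_of_lt_left hγ,
      fun τ h0 hτ => ?_, fun τ hτ => ?_⟩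
    · exact (ha τ h0 hτ).mono hH.le (by omega) (by linarith) (le_max_left _ _) h0
    · exact (hb τ hτ).mono hH'.le (by omega) (by linarith) (le_max_right _ _) hτ.le
  intro H s γ hH _ hγ ha hb
  refine ⟨⟨4 * H, by positivity, TauLeap.localErrorBound_of_derivBound hH hγ
    (fun x y => hX.contDiffOn_transition x y (q + 1)) h3 ha hb⟩, ?_⟩
  intro C hC hloc T π _ hπ p₀ hp hpM Ω' _ μ _ Y hY
  set m := max (lam r) (max (lam (s + r)) γ)
  set pY : TauLeap.State N → ℝ := fun y => μ.real {ω | Y T ω = y} with hpY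
  set pX := TauLeap.matApply (TauLeap.transition X Pr T) p₀ with hpX
  have herr : TauLeap.momVar nrm r (pY - pX)
      ≤ ENNReal.ofReal (C * (Real.exp (m * T) * T * π.size ^ q))
        * TauLeap.momVar nrm (s + r) p₀ := by
    have := TauLeap.momVar_law_sub_le hX hφ h2 (h6 r) hC.le hloc hπ hp hpM hY (Fin.last π.n)
    rwa [π.last] at this
  have hXfin : TauLeap.momVar nrm r pX < ∞ :=
    (hX.momVar_law_le (h2 r) T.2 p₀).trans_lt (ENNReal.mul_lt_top ENNReal.ofReal_lt_top (hpM r))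
  -- Moments of the numerical law are finite because it differs from the exact law by an error of
  -- finite moment variation.
  have hYfin : TauLeap.momVar nrm r pY < ∞ := by
    have h := TauLeap.momVar_add_le nrm r (pY - pX) pX
    rw [sub_add_cancel] at h
    exact h.trans_lt (ENNReal.add_lt_top.2
      ⟨herr.trans_lt (ENNReal.mul_lt_top ENNReal.ofReal_lt_top (hpM _)), hXfin⟩)
  obtain ⟨hYI, hYE⟩ := TauLeap.integrable_absv_pow (hY.measurable T le_rfl)
    (fun _ => measureReal_nonneg) (p := pY) (fun y => (ofReal_measureReal (μ := μ)).symm) hYfin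
  have hpX0 := TauLeap.IsProb.matApply (hX.isProb_transition T) hp
  obtain ⟨hXI, hXE⟩ := TauLeap.integrable_absv_pow (hX.measurable T) hpX0.1
    (hX.initLaw_apply hp T) hXfin
  obtain ⟨hII, hIE⟩ := TauLeap.integrable_absv_pow (hX.measurable 0) hp.1
    (μ := TauLeap.initLaw Pr p₀)
    (fun y => by rw [hX.initLaw_apply hp 0, NNReal.coe_zero, hX.matApply_transition_zero])
    (hpM (s + r))
  have hsz := π.size_nonneg
  have hE0 : 0 ≤ ∫ ω, TauLeap.absv nrm (X 0 ω) ^ (s + r) ∂(TauLeap.initLaw Pr p₀) :=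
    integral_nonneg fun ω => pow_nonneg (TauLeap.absv_nonneg nrm _) _
  have hmain : |(∫ ω, TauLeap.absv nrm (Y T ω) ^ r ∂μ)
        - ∫ ω, TauLeap.absv nrm (X T ω) ^ r ∂(TauLeap.initLaw Pr p₀)|
      ≤ C * (1 + ∫ ω, TauLeap.absv nrm (X 0 ω) ^ (s + r) ∂(TauLeap.initLaw Pr p₀))
          * T * Real.exp (m * T) * π.size ^ q := by
    rw [← ENNReal.ofReal_le_ofReal_iff (by positivity), hYE, hXE,
      ← (TauLeap.summable_of_momVar_lt_top hYfin).tsum_sub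
        (TauLeap.summable_of_momVar_lt_top hXfin)]
    simp only [← mul_sub]
    refine (TauLeap.ofReal_abs_tsum_le nrm r (pY - pX)).trans ?_
    -- This 2 cancels the 1/2 in the moment variation of `p₀`.
    refine (mul_le_mul_right herr 2).trans (le_of_eq ?_)
    rw [hp.momVar_eq (hpM (s + r)), ← hIE, ← ENNReal.ofReal_ofNat 2,
      ← ENNReal.ofReal_mul (by positivity), ← ENNReal.ofReal_mul (by positivity)]
    congr 1
    ring
  refine ⟨hYI, hXI, hII, hmain, fun hge => hmain.trans ?_⟩
  -- On the support of `p₀` the norm is at least 1, so the initial moment dominates the total mass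
  -- and `1 + E ≤ 2 * E`.
  have h1 : 1 ≤ ∫ ω, TauLeap.absv nrm (X 0 ω) ^ (s + r) ∂(TauLeap.initLaw Pr p₀) := by
    rw [hIE]
    refine hasSum_le (fun x => ?_) hp.2
      (TauLeap.summable_of_momVar_lt_top (hpM (s + r))).hasSum
    by_cases hx : p₀ x = 0
    · simp [hx]
    · exact le_mul_of_one_le_left (hp.1 x) (one_le_pow₀ (hge x hx))
  have h2' : C * (1 + ∫ ω, TauLeap.absv nrm (X 0 ω) ^ (s + r) ∂(TauLeap.initLaw Pr p₀))
      ≤ 2 * C * ∫ ω, TauLeap.absv nrm (X 0 ω) ^ (s + r) ∂(TauLeap.initLaw Pr p₀) := by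
    nlinarith
  gcongr
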